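/- Let $(\Omega,\mathcal F,P)$ be a probability space and let $\ell:\mathbb{R}^d\to(-\infty,\infty]$ be a loss function: $\ell$ is increasing for the componentwise order, convex and lower semicontinuous, $\inf\ell<0$, and $\ell(x)\ge\sum_k x_k-c$ for some constant $c\in\mathbb{R}$. Put $\theta(x)=\ell(|x|)$, where $|x|=(|x_1|,\dots,|x_d|)$, and write $f^*(y)=\sup_{x}\{x\cdot y-f(x)\}$ for convex conjugates. Let $L^0$ be the space of $\mathbb{R}^d$-valued random vectors modulo $P$-almost sure equality and $$M^\theta=\{X\in L^0: E[\theta(\lambda X)]<\infty\ \text{for all }\lambda\ge 0\},\qquad L^{\theta^*}=\{Z\in L^0: E[\theta^*(Z/\lambda)]<\infty\ \text{for some }\lambda>0\},$$ where $M^\theta$ carries the Luxemburg norm $\|X\|=\inf\{\lambda>0: E[\theta(X/\lambda)-\theta(0)]\le 1\}$. For a random vector $X$ let $$A(X)=\{m\in\mathbb{R}^d: E[\ell(X-m)]\le 0\},\qquad R(X)=\inf\Big\{\sum_k m_k: m\in A(X)\Big\}.$$ Let $\mathcal Q^{\theta^*}$ be the set of $d$-dimensional measure densities $\frac{dQ}{dP}=(Z_1,\dots,Z_d)\in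 L^{\theta^*}$ with $Z_k\ge 0$ and $E[Z_k]=1$ for every $k$, and write $E_Q[X]=E[\frac{dQ}{dP}\cdot X]$. Theorem. On $M^\theta$ the multivariate shortfall risk $R$ is real-valued, convex, monotone ($R(X)\le R(Y)$ if $X\le Y$ almost surely) and translation invariant ($R(X+m)=R(X)+\sum_k m_k$ for $m\in\mathbb{R}^d$). It is continuous, and it is subdifferentiable: at every $X\in M^\theta$ there is a continuous linear functional $\xi$ on $M^\theta$ with $R(Y)\ge R(X)+\xi(Y-X)$ for all $Y\in M^\theta$. If $\ell$ is positively homogeneous ($\ell(\lambda x)=\lambda\ell(x)$ for $\lambda>0$), then so is $R$. Moreover, for $X\in M^\theta$ and $Q\in\mathcal Q^{\theta^*}$ the variable $\frac{dQ}{dP}\cdot X$ is integrable, and $$R(X)=\max_{Q\in\mathcal Q^{\theta^*}}\big\{E_Q[X]-\alpha(Q)\big\},\quad X\in M^\theta,\qquad\text{where}\quad \alpha(Q)=\inf_{\lambda>0}E\Big[\lambda\,\ell^*\Big(\frac{dQ}{\lambda\,dP}\Big)\Big].$$ -/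

import Mathlib

open MeasureTheory

noncomputable section

namespace Shortfall

variable {Ω : Type*} [MeasurableSpace Ω] {d : ℕ}

/-- A loss function `ℓ : ℝ^d → (-∞, ∞]`: increasing, convex, lower semicontinuous, with
`inf ℓ < 0` and `ℓ x ≥ ∑ x_k - c` for some real `c` (so that `-∞` is not a value). -/
structure IsLossFunction (ℓ : (Fin d → ℝ) → EReal) : Prop where
  mono : Monotone ℓ
  convex : ∀ (x y : Fin d → ℝ) (a b : ℝ), 0 < a → 0 < b → a + b = 1 →
    ℓ (a • x + b • y) ≤ (a : EReal) * ℓ x + (b : EReal) * ℓ y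
  lsc : LowerSemicontinuous ℓ
  inf_neg : ⨅ x, ℓ x < 0
  lower_bound : ∃ c : ℝ, ∀ x, ((∑ k, x k - c : ℝ) : EReal) ≤ ℓ x

/-- Expectation of an extended real valued random variable, `E[f⁺] - E[f⁻]`.
It is only applied to variables that are bounded below by an integrable one. -/
def eexp (P : Measure Ω) (f : Ω → EReal) : EReal :=
  ((∫⁻ ω, (f ω).toENNReal ∂P : ENNReal) : EReal) - ((∫⁻ ω, (-f ω).toENNReal ∂P : ENNReal) : EReal)

/-- The convex conjugate `f^*(y) = sup_x {x · y - f x}`. -/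
def conj (f : (Fin d → ℝ) → EReal) (y : Fin d → ℝ) : EReal :=
  ⨆ x : Fin d → ℝ, (((∑ k, x k * y k : ℝ) : EReal) - f x)

/-- `θ x = ℓ |x|`, with the componentwise absolute value. -/
def theta (ℓ : (Fin d → ℝ) → EReal) (x : Fin d → ℝ) : EReal := ℓ |x|

/-- The multivariate Orlicz heart `M^θ`, as a subset of `L^0(ℝ^d)`. -/
def orliczHeart (θ : (Fin d → ℝ) → EReal) (P : Measure Ω) : Set (Ω →ₘ[P] (Fin d → ℝ)) :=
  {X | ∀ a : ℝ, 0 ≤ a → eexp P (fun ω => θ (a • X ω)) < ⊤}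

/-- The multivariate Orlicz space `L^θ`, as a subset of `L^0(ℝ^d)`. -/
def orliczSpace (θ : (Fin d → ℝ) → EReal) (P : Measure Ω) : Set (Ω →ₘ[P] (Fin d → ℝ)) :=
  {X | ∃ a : ℝ, 0 < a ∧ eexp P (fun ω => θ (a⁻¹ • X ω)) < ⊤}

/-- The Luxemburg norm of the Young function `θ - θ 0`
(this is `θ` itself when `θ 0 = 0`). -/
def luxNorm (θ : (Fin d → ℝ) → EReal) (P : Measure Ω) (X : Ω →ₘ[P] (Fin d → ℝ)) : ℝ :=
  sInf {a : ℝ | 0 < a ∧ eexp P (fun ω => θ (a⁻¹ • X ω) - θ 0) ≤ 1}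

/-- Continuity on `M^θ` of a real function, for the Luxemburg norm. -/
def ContinuousOnHeart (θ : (Fin d → ℝ) → EReal) (P : Measure Ω)
    (f : (Ω →ₘ[P] (Fin d → ℝ)) → ℝ) : Prop :=
  ∀ X ∈ orliczHeart θ P, ∀ ε > 0, ∃ δ > 0, ∀ Y ∈ orliczHeart θ P,
    luxNorm θ P (Y - X) < δ → |f Y - f X| < ε

/-- `ξ` restricts to a continuous linear functional on `M^θ`. -/
structure IsDualFunctional (θ : (Fin d → ℝ) → EReal) (P : Measure Ω)
    (ξ : (Ω →ₘ[P] (Fin d → ℝ)) → ℝ) : Prop where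
  add : ∀ X ∈ orliczHeart θ P, ∀ Y ∈ orliczHeart θ P, ξ (X + Y) = ξ X + ξ Y
  smul : ∀ (a : ℝ), ∀ X ∈ orliczHeart θ P, ξ (a • X) = a * ξ X
  bound : ∃ C : ℝ, ∀ X ∈ orliczHeart θ P, |ξ X| ≤ C * luxNorm θ P X

/-- The subdifferential at `X` of a real function on `M^θ`. -/
def subdifferential (θ : (Fin d → ℝ) → EReal) (P : Measure Ω)
    (f : (Ω →ₘ[P] (Fin d → ℝ)) → ℝ) (X : Ω →ₘ[P] (Fin d → ℝ)) :
    Set ((Ω →ₘ[P] (Fin d → ℝ)) → ℝ) :=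
  {ξ | IsDualFunctional θ P ξ ∧ ∀ Y ∈ orliczHeart θ P, f X + ξ (Y - X) ≤ f Y}

/-- The set `A(X)` of acceptable monetary allocations for `X`. -/
def acceptable (ℓ : (Fin d → ℝ) → EReal) (P : Measure Ω) (X : Ω →ₘ[P] (Fin d → ℝ)) :
    Set (Fin d → ℝ) :=
  {m | eexp P (fun ω => ℓ (X ω - m)) ≤ 0}

/-- The multivariate shortfall risk `R(X) = inf {∑ m_k : m ∈ A(X)}`. -/
def risk (ℓ : (Fin d → ℝ) → EReal) (P : Measure Ω) (X : Ω →ₘ[P] (Fin d → ℝ)) : EReal :=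
  ⨅ m ∈ acceptable ℓ P X, ((∑ k, m k : ℝ) : EReal)

/-- The `d`-dimensional measure densities in `L^{θ^*}`: `Z ≥ 0` with `E[Z_k] = 1` for every `k`. -/
def densities (θ : (Fin d → ℝ) → EReal) (P : Measure Ω) : Set (Ω →ₘ[P] (Fin d → ℝ)) :=
  {Z | Z ∈ orliczSpace (conj θ) P ∧ 0 ≤ Z ∧ ∀ k, Integrable (fun ω => Z ω k) P ∧
    ∫ ω, Z ω k ∂P = 1}

/-- The penalty `α(Q) = inf_{λ > 0} E[λ ℓ^*(Z / λ)]`, where `Z = dQ/dP`. -/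
def penalty (ℓ : (Fin d → ℝ) → EReal) (P : Measure Ω) (Z : Ω →ₘ[P] (Fin d → ℝ)) : EReal :=
  ⨅ l : {l : ℝ // 0 < l}, eexp P (fun ω => ((l : ℝ) : EReal) * conj ℓ ((l : ℝ)⁻¹ • Z ω))

end Shortfall

end

open Filter Topology

namespace Shortfall

variable {Ω : Type*} [MeasurableSpace Ω] {d : ℕ}

/-! The risk is the value of a convex program with the single constraint E[ℓ(X - m)] ≤ 0. Since ℓ is
below some -δ < 0 at a point, subtracting a large constant makes the constraint strict (Slater's
condition). Real-valuedness, convexity, monotonicity, translation invariance and homogeneity come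
directly from the constraint and from ℓ(x) ≥ ∑ x_k - c. Weak duality is Fenchel's inequality applied
pointwise to X - m and Z / λ.

The substance is attainment. The perspective of Y ↦ E[ℓ(X + Y)] has a convex cone as epigraph, and
`riesz_extension` gives a linear ξ and a multiplier l ≥ 0 with ξ(Y) - l E[ℓ(Y)] ≤ γ := ξ(X) - R(X)
and ξ(m) = ∑ m_k on constants (`exists_supporting_functional`). This ξ is positive, but on
indicators only finitely additive. Its countably additive part has a density Z, and the remainder
lives on sets of arbitrarily small probability (`exists_density_of_additive`), where a test vector
may take any value of finite loss at vanishing cost. So the remainder enters the bound as a separate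
support term, and spreading its mass uniformly, Z + (1 - E[Z]), gives a measure density with E[l
ℓ^*((Z + 1 - E[Z]) / l)] ≤ γ (`IsSupporting.exists_dual_density`).

It remains that ξ(X) is the expectation of X under this density. If X_k is not almost surely 0,
membership in the heart makes ℓ finite at every n e_k; then the remainder in coordinate k vanishes
and ξ is continuous along dominated sequences there (`IsSupporting.tendsto_map_onCoord`). The other
coordinates contribute nothing. If l = 0, then X = 0 almost surely and the density 1 is optimal
(`exists_optimal_density`).

An optimal density is a subgradient, and it gives lower continuity. Upper continuity follows from
convexity and a local upper bound, again by Slater. -/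

/-! ### Expectations of extended real variables -/

/-- The expectation of `f` is at most `r`, witnessed by an integrable real majorant. -/
def ExpLE (P : Measure Ω) (f : Ω → EReal) (r : ℝ) : Prop :=
  ∃ h : Ω → ℝ, Integrable h P ∧ (∀ᵐ ω ∂P, f ω ≤ (h ω : EReal)) ∧ ∫ ω, h ω ∂P ≤ r

theorem eexp_mono_ae {P : Measure Ω} {f g : Ω → EReal} (h : ∀ᵐ ω ∂P, f ω ≤ g ω) :
    eexp P f ≤ eexp P g := by
  unfold eexp
  apply EReal.sub_le_sub
  · rw [EReal.coe_ennreal_le_coe_ennreal_iff]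
    exact lintegral_mono_ae (h.mono fun ω hω => EReal.toENNReal_le_toENNReal hω)
  · rw [EReal.coe_ennreal_le_coe_ennreal_iff]
    exact lintegral_mono_ae (h.mono fun ω hω =>
      EReal.toENNReal_le_toENNReal (EReal.neg_le_neg_iff.2 hω))

theorem eexp_congr_ae {P : Measure Ω} {f g : Ω → EReal} (h : ∀ᵐ ω ∂P, f ω = g ω) :
    eexp P f = eexp P g :=
  le_antisymm (eexp_mono_ae (h.mono fun _ hω => hω.le)) (eexp_mono_ae (h.mono fun _ hω => hω.ge))

theorem eexp_coe {P : Measure Ω} {h : Ω → ℝ} (hh : Integrable h P) :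
    eexp P (fun ω => (h ω : EReal)) = ((∫ ω, h ω ∂P : ℝ) : EReal) := by
  have h1 : ∫⁻ ω, ENNReal.ofReal (h ω) ∂P ≠ ⊤ := hh.lintegral_lt_top.ne
  have h2 : ∫⁻ ω, ENNReal.ofReal (-h ω) ∂P ≠ ⊤ := hh.neg.lintegral_lt_top.ne
  rw [integral_eq_lintegral_pos_part_sub_lintegral_neg_part hh, EReal.coe_sub]
  unfold eexp
  have e1 : ∀ x : ℝ, (x : EReal).toENNReal = ENNReal.ofReal x := fun x => by
    simp [EReal.toENNReal_of_ne_top]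
  have e2 : ∀ x : ℝ, (-(x : EReal)).toENNReal = ENNReal.ofReal (-x) := fun x => by
    rw [← EReal.coe_neg, e1]
  simp only [e1, e2]
  rw [EReal.coe_ennreal_toReal h1, EReal.coe_ennreal_toReal h2]

theorem ExpLE.eexp_le {P : Measure Ω} {f : Ω → EReal} {r : ℝ} (h : ExpLE P f r) :
    eexp P f ≤ (r : EReal) := by
  obtain ⟨g, hg, hfg, hr⟩ := h
  refine (eexp_mono_ae hfg).trans ?_
  rw [eexp_coe hg]
  exact_mod_cast hr

theorem ExpLE.mono {P : Measure Ω} {f g : Ω → EReal} {r s : ℝ} (h : ExpLE P f r)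
    (hgf : ∀ᵐ ω ∂P, g ω ≤ f ω) (hrs : r ≤ s) : ExpLE P g s := by
  obtain ⟨u, hu, hfu, hr⟩ := h
  refine ⟨u, hu, ?_, hr.trans hrs⟩
  filter_upwards [hfu, hgf] with ω h1 h2 using h2.trans h1

theorem expLE_const {P : Measure Ω} [IsProbabilityMeasure P] {f : Ω → EReal} {r : ℝ}
    (h : ∀ᵐ ω ∂P, f ω ≤ (r : EReal)) : ExpLE P f r :=
  ⟨fun _ => r, integrable_const _, h, by simp⟩

/-- The integrable minorant makes the negative part have finite integral, so the difference defining
`eexp` can stay below `⊤` only if the positive part does too. This is what makes majorants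
interchangeable with `eexp`. -/
theorem expLE_of_eexp_lt_top {P : Measure Ω} {f : Ω → EReal} {g : Ω → ℝ}
    (hf : AEMeasurable f P) (hg : Integrable g P) (hgf : ∀ᵐ ω ∂P, (g ω : EReal) ≤ f ω)
    (h : eexp P f < ⊤) :
    Integrable (fun ω => (f ω).toReal) P ∧ (∀ᵐ ω ∂P, f ω = ((f ω).toReal : EReal)) ∧
      ((∫ ω, (f ω).toReal ∂P : ℝ) : EReal) = eexp P f := by
  have hneg : ∫⁻ ω, (-f ω).toENNReal ∂P < ⊤ := by
    refine lt_of_le_of_lt (lintegral_mono_ae (g := fun ω => ENNReal.ofReal (-g ω)) ?_)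
      hg.neg.lintegral_lt_top
    filter_upwards [hgf] with ω hω
    have : -f ω ≤ ((-g ω : ℝ) : EReal) := by
      rw [EReal.coe_neg]; exact EReal.neg_le_neg_iff.2 hω
    refine (EReal.toENNReal_le_toENNReal this).trans ?_
    simp [EReal.toENNReal_of_ne_top]
  have hpos : ∫⁻ ω, (f ω).toENNReal ∂P < ⊤ := by
    by_contra hcon
    have : ∫⁻ ω, (f ω).toENNReal ∂P = ⊤ := by simpa using hcon
    unfold eexp at h
    rw [this, ← EReal.coe_ennreal_toReal hneg.ne] at h
    simp at h
  have hm : AEMeasurable (fun ω => (f ω).toENNReal) P := hf.ereal_toENNReal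
  have hfin := ae_lt_top' hm hpos.ne
  have heq : ∀ᵐ ω ∂P, f ω = ((f ω).toReal : EReal) := by
    filter_upwards [hgf, hfin] with ω h1 h2
    rw [EReal.coe_toReal]
    · intro h3; rw [h3] at h2; simp at h2
    · intro h3; rw [h3] at h1; simp at h1
  have hint : Integrable (fun ω => (f ω).toReal) P := by
    refine ⟨hf.ereal_toReal.aestronglyMeasurable, ?_⟩
    have : ∫⁻ ω, ((f ω).toENNReal + (-f ω).toENNReal) ∂P < ⊤ := by
      rw [lintegral_add_left' hm]
      exact ENNReal.add_lt_top.2 ⟨hpos, hneg⟩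
    refine lt_of_le_of_lt (lintegral_mono_ae ?_) this
    filter_upwards [heq] with ω hω
    set x := (f ω).toReal
    rw [hω, ← EReal.coe_neg]
    rw [EReal.toENNReal_of_ne_top (by simp), EReal.toENNReal_of_ne_top (by simp)]
    simp only [EReal.toReal_coe]
    rw [← ofReal_norm, Real.norm_eq_abs]
    rcases le_total 0 x with hx | hx
    · rw [abs_of_nonneg hx]; exact le_self_add
    · rw [abs_of_nonpos hx]; exact le_add_self
  refine ⟨hint, heq, ?_⟩
  rw [← eexp_coe hint]
  exact eexp_congr_ae (heq.mono fun ω h => h.symm)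

theorem expLE_of_eexp_le {P : Measure Ω} {f : Ω → EReal} {g : Ω → ℝ} {r : ℝ}
    (hf : AEMeasurable f P) (hg : Integrable g P) (hgf : ∀ᵐ ω ∂P, (g ω : EReal) ≤ f ω)
    (h : eexp P f ≤ (r : EReal)) : ExpLE P f r := by
  obtain ⟨h1, h2, h3⟩ := expLE_of_eexp_lt_top hf hg hgf (h.trans_lt (EReal.coe_lt_top r))
  refine ⟨_, h1, h2.mono fun ω h => h.le, ?_⟩
  rw [← h3] at h
  exact_mod_cast h

theorem exists_expLE_of_eexp_lt_top {P : Measure Ω} {f : Ω → EReal} {g : Ω → ℝ}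
    (hf : AEMeasurable f P) (hg : Integrable g P) (hgf : ∀ᵐ ω ∂P, (g ω : EReal) ≤ f ω)
    (h : eexp P f < ⊤) : ∃ r, ExpLE P f r := by
  obtain ⟨h1, h2, _⟩ := expLE_of_eexp_lt_top hf hg hgf h
  exact ⟨_, _, h1, h2.mono fun ω h => h.le, le_rfl⟩

/-- A lower bound by an integrable variable bounds the expectation from below. -/
theorem ExpLE.integral_le {P : Measure Ω} {f : Ω → EReal} {g : Ω → ℝ} {r : ℝ}
    (h : ExpLE P f r) (hg : Integrable g P) (hgf : ∀ᵐ ω ∂P, (g ω : EReal) ≤ f ω) :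
    ∫ ω, g ω ∂P ≤ r := by
  obtain ⟨u, hu, hfu, hr⟩ := h
  refine le_trans (integral_mono_ae hg hu ?_) hr
  filter_upwards [hfu, hgf] with ω h1 h2
  exact_mod_cast h2.trans h1

theorem integral_coe_le_eexp {P : Measure Ω} {f : Ω → EReal} {g : Ω → ℝ}
    (hg : Integrable g P) (hgf : ∀ᵐ ω ∂P, (g ω : EReal) ≤ f ω) :
    ((∫ ω, g ω ∂P : ℝ) : EReal) ≤ eexp P f := by
  rw [← eexp_coe hg]
  exact eexp_mono_ae hgf

theorem integrable_partialSups {P : Measure Ω} {q : ℕ → Ω → ℝ} (hq : ∀ n, Integrable (q n) P)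
    (n : ℕ) : Integrable (partialSups q n) P := by
  induction n with
  | zero => simpa using hq 0
  | succ n ih => rw [partialSups_add_one]; exact ih.sup (hq _)

/-- Monotone convergence for the supremum of a sequence of integrable variables. -/
theorem expLE_iSup {P : Measure Ω} {q : ℕ → Ω → ℝ} {r : ℝ} (hq : ∀ n, Integrable (q n) P)
    (h : ∀ n, ∫ ω, partialSups q n ω ∂P ≤ r) :
    ExpLE P (fun ω => ⨆ n, (q n ω : EReal)) r := by
  have hi := integrable_partialSups hq
  -- Subtracting `q 0` makes the increasing running maxima nonnegative, as monotone convergence for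
  -- the Lebesgue integral requires.
  set G : ℕ → Ω → ENNReal := fun n ω => ENNReal.ofReal (partialSups q n ω - q 0 ω) with hG
  have hmono : ∀ ω, Monotone fun n => G n ω := fun ω a b hab =>
    ENNReal.ofReal_le_ofReal (sub_le_sub_right ((partialSups q).monotone hab ω) _)
  have h0 : ∀ n ω, 0 ≤ partialSups q n ω - q 0 ω := fun n ω =>
    sub_nonneg.2 (le_partialSups_of_le q (Nat.zero_le n) ω)
  have hGm : ∀ n, AEMeasurable (G n) P := fun n =>
    ((hi n).sub (hq 0)).aestronglyMeasurable.aemeasurable.ennreal_ofReal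
  have hle : ∫⁻ ω, ⨆ n, G n ω ∂P ≤ ENNReal.ofReal (r - ∫ ω, q 0 ω ∂P) := by
    rw [lintegral_iSup' hGm (Eventually.of_forall hmono)]
    refine iSup_le fun n => ?_
    have := ofReal_integral_eq_lintegral_ofReal ((hi n).sub (hq 0))
      (Eventually.of_forall fun ω => h0 n ω)
    simp only [Pi.sub_apply] at this
    simp only [hG]
    rw [← this]
    refine ENNReal.ofReal_le_ofReal ?_
    have := integral_sub (hi n) (hq 0)
    rw [this]
    exact sub_le_sub_right (h n) _
  have hr0 : 0 ≤ r - ∫ ω, q 0 ω ∂P := by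
    have := h 0
    rw [partialSups_zero] at this
    linarith
  have hm : AEMeasurable (fun ω => ⨆ n, G n ω) P := .iSup hGm
  have hlt : ∫⁻ ω, ⨆ n, G n ω ∂P ≠ ⊤ := (hle.trans_lt ENNReal.ofReal_lt_top).ne
  have hint := integrable_toReal_of_lintegral_ne_top hm hlt
  refine ⟨fun ω => q 0 ω + (⨆ n, G n ω).toReal, (hq 0).add hint, ?_, ?_⟩
  · filter_upwards [ae_lt_top' hm hlt] with ω hω
    refine iSup_le fun n => ?_
    have h1 : partialSups q n ω - q 0 ω ≤ (⨆ n, G n ω).toReal := by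
      have := ENNReal.toReal_mono hω.ne (le_iSup (fun n => G n ω) n)
      rwa [hG, ENNReal.toReal_ofReal (h0 n ω)] at this
    have h2 : q n ω ≤ partialSups q n ω := le_partialSups q n ω
    exact_mod_cast (by linarith : q n ω ≤ q 0 ω + (⨆ n, G n ω).toReal)
  · rw [integral_add (hq 0) hint, integral_toReal hm (ae_lt_top' hm hlt)]
    have := ENNReal.toReal_mono ENNReal.ofReal_ne_top hle
    rw [ENNReal.toReal_ofReal hr0] at this
    linarith

/-! ### Loss functions, the heart, and Slater's condition -/

theorem IsLossFunction.ne_bot {ℓ : (Fin d → ℝ) → EReal} (hℓ : IsLossFunction ℓ)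
    (x : Fin d → ℝ) : ℓ x ≠ ⊥ := by
  obtain ⟨c, hc⟩ := hℓ.lower_bound
  intro h
  have := hc x
  rw [h] at this
  exact EReal.coe_ne_bot _ (le_bot_iff.1 this)

theorem IsLossFunction.measurable {ℓ : (Fin d → ℝ) → EReal} (hℓ : IsLossFunction ℓ) :
    Measurable ℓ :=
  hℓ.lsc.measurable

theorem IsLossFunction.exists_neg {ℓ : (Fin d → ℝ) → EReal} (hℓ : IsLossFunction ℓ) :
    ∃ (δ : ℝ) (x : Fin d → ℝ), 0 < δ ∧ ℓ x < ((-δ : ℝ) : EReal) := by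
  obtain ⟨x, hx⟩ := iInf_lt_iff.1 hℓ.inf_neg
  obtain ⟨q, h1, h2⟩ := EReal.lt_iff_exists_real_btwn.1 hx
  exact ⟨-q, x, by simpa using h2, by simpa using h1⟩

theorem IsLossFunction.le_convexComb {ℓ : (Fin d → ℝ) → EReal} (hℓ : IsLossFunction ℓ)
    {x y : Fin d → ℝ} {a b r s : ℝ} (ha : 0 < a) (hb : 0 < b) (hab : a + b = 1)
    (hx : ℓ x ≤ (r : EReal)) (hy : ℓ y ≤ (s : EReal)) :
    ℓ (a • x + b • y) ≤ ((a * r + b * s : ℝ) : EReal) := by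
  refine (hℓ.convex x y a b ha hb hab).trans ?_
  rw [EReal.coe_add, EReal.coe_mul, EReal.coe_mul]
  have ha' : (0 : EReal) ≤ a := by exact_mod_cast ha.le
  have hb' : (0 : EReal) ≤ b := by exact_mod_cast hb.le
  exact add_le_add (mul_le_mul_of_nonneg_left hx ha') (mul_le_mul_of_nonneg_left hy hb')

theorem theta_le_theta {ℓ : (Fin d → ℝ) → EReal} (hℓ : IsLossFunction ℓ) {x y : Fin d → ℝ}
    (h : ∀ k, |x k| ≤ |y k|) : theta ℓ x ≤ theta ℓ y :=
  hℓ.mono fun k => by simpa using h k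

theorem le_theta {ℓ : (Fin d → ℝ) → EReal} (hℓ : IsLossFunction ℓ) {x y : Fin d → ℝ}
    (h : ∀ k, x k ≤ |y k|) : ℓ x ≤ theta ℓ y :=
  hℓ.mono fun k => by simpa using h k

theorem ExpLE.convexComb {ℓ : (Fin d → ℝ) → EReal} (hℓ : IsLossFunction ℓ) {P : Measure Ω}
    {U V : Ω → Fin d → ℝ} {a b r s : ℝ} (ha : 0 < a) (hb : 0 < b) (hab : a + b = 1)
    (hU : ExpLE P (fun ω => ℓ (U ω)) r) (hV : ExpLE P (fun ω => ℓ (V ω)) s) :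
    ExpLE P (fun ω => ℓ (a • U ω + b • V ω)) (a * r + b * s) := by
  obtain ⟨g, hg, hUg, hr⟩ := hU
  obtain ⟨h, hh, hVh, hs⟩ := hV
  refine ⟨fun ω => a * g ω + b * h ω, (hg.const_mul a).add (hh.const_mul b), ?_, ?_⟩
  · filter_upwards [hUg, hVh] with ω h1 h2 using hℓ.le_convexComb ha hb hab h1 h2
  · rw [integral_add (hg.const_mul a) (hh.const_mul b), integral_const_mul, integral_const_mul]
    gcongr

/-- A measurable representative of an element of the Orlicz heart. -/
def InHeart (ℓ : (Fin d → ℝ) → EReal) (P : Measure Ω) (X : Ω → Fin d → ℝ) : Prop :=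
  Measurable X ∧ ∀ a : ℝ, 0 ≤ a → ∃ r, ExpLE P (fun ω => theta ℓ (a • X ω)) r

/-- The vectors that are dominated, coordinate by coordinate, by an affine function of `|X|`. -/
def dominated (X : Ω → Fin d → ℝ) : Submodule ℝ (Ω → Fin d → ℝ) where
  carrier := {Y | Measurable Y ∧ ∃ a b : ℝ, 0 ≤ a ∧ ∀ ω k, |Y ω k| ≤ a * |X ω k| + b}
  zero_mem' := ⟨measurable_zero, 0, 0, le_rfl, fun ω k => by simp⟩
  add_mem' := by
    rintro Y Z ⟨hY, a, b, ha, h⟩ ⟨hZ, a', b', ha', h'⟩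
    refine ⟨hY.add hZ, a + a', b + b', by positivity, fun ω k => ?_⟩
    have h1 := h ω k
    have h2 := h' ω k
    have h3 := abs_add_le (Y ω k) (Z ω k)
    simp only [Pi.add_apply]
    linarith
  smul_mem' := by
    rintro c Y ⟨hY, a, b, ha, h⟩
    refine ⟨hY.const_smul c, |c| * a, |c| * b, by positivity, fun ω k => ?_⟩
    simp only [Pi.smul_apply, smul_eq_mul, abs_mul]
    have := mul_le_mul_of_nonneg_left (h ω k) (abs_nonneg c)
    linarith

theorem InHeart.integrable {ℓ : (Fin d → ℝ) → EReal} (hℓ : IsLossFunction ℓ) {P : Measure Ω}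
    [IsProbabilityMeasure P] {X : Ω → Fin d → ℝ} (hX : InHeart ℓ P X) (k : Fin d) :
    Integrable (fun ω => X ω k) P := by
  obtain ⟨c, hc⟩ := hℓ.lower_bound
  obtain ⟨hm, h⟩ := hX
  obtain ⟨r, g, hg, hle, -⟩ := h 1 zero_le_one
  refine (hg.add (integrable_const c)).mono' (measurable_pi_iff.1 hm k).aestronglyMeasurable ?_
  filter_upwards [hle] with ω hω
  have h1 := (hc |(1 : ℝ) • X ω|).trans hω
  have h2 : ∑ k, |(1 : ℝ) • X ω| k - c ≤ g ω := by exact_mod_cast h1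
  have h3 : |X ω k| ≤ ∑ k, |(1 : ℝ) • X ω| k := by
    simpa using Finset.single_le_sum (f := fun k => |X ω k|) (fun _ _ => abs_nonneg _)
      (Finset.mem_univ k)
  simp only [Real.norm_eq_abs, Pi.add_apply]
  linarith

/-- If `ℓ ∘ Y n` has an integrable majorant and `Y n ≤ x` eventually at each point, then
`E[ℓ (Y n)]` is eventually below every number above `ℓ x`. -/
theorem eventually_expLE {ℓ : (Fin d → ℝ) → EReal} (hℓ : IsLossFunction ℓ) {P : Measure Ω}
    [IsProbabilityMeasure P] {Y : ℕ → Ω → Fin d → ℝ} (hY : ∀ n, Measurable (Y n)) {T : Ω → ℝ}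
    (hT : Integrable T P) {x : Fin d → ℝ} {r : ℝ} (hx : ℓ x < (r : EReal))
    (hle : ∀ᶠ n in atTop, ∀ᵐ ω ∂P, ℓ (Y n ω) ≤ (T ω : EReal))
    (hev : ∀ ω, ∀ᶠ n in atTop, Y n ω ≤ x) :
    ∀ᶠ n in atTop, ExpLE P (fun ω => ℓ (Y n ω)) r := by
  classical
  obtain ⟨s, hs1, hs2⟩ := EReal.lt_iff_exists_real_btwn.1 hx
  have hs2' : s < r := by exact_mod_cast hs2
  have hms : ∀ n, MeasurableSet {ω | Y n ω ≤ x} := fun n => by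
    have : {ω | Y n ω ≤ x} = ⋂ k, {ω | Y n ω k ≤ x k} := by
      ext ω; simp [Pi.le_def]
    rw [this]
    exact MeasurableSet.iInter fun k =>
      measurableSet_le (measurable_pi_iff.1 (hY n) k) measurable_const
  -- By monotonicity `h n` majorizes ℓ(Y n) once `T` does, with `s` strictly between ℓ(x) and r. It
  -- converges pointwise to `s`, so its integral is eventually below r.
  set h : ℕ → Ω → ℝ := fun n ω => if Y n ω ≤ x then s else T ω with hh
  have hsm : ∀ n, AEStronglyMeasurable (h n) P := fun n =>
    AEStronglyMeasurable.piecewise (hms n) aestronglyMeasurable_const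
      hT.aestronglyMeasurable.restrict
  have hb : ∀ n ω, ‖h n ω‖ ≤ |s| + |T ω| := fun n ω => by
    simp only [hh, Real.norm_eq_abs]
    split_ifs
    · linarith [abs_nonneg (T ω)]
    · linarith [abs_nonneg s]
  have hbi : Integrable (fun ω => |s| + |T ω|) P := (integrable_const _).add hT.abs
  have hlim : Tendsto (fun n => ∫ ω, h n ω ∂P) atTop (𝓝 (∫ _ω, s ∂P)) := by
    refine tendsto_integral_of_dominated_convergence _ hsm hbi
      (fun n => Eventually.of_forall (hb n)) (Eventually.of_forall fun ω => ?_)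
    refine tendsto_const_nhds.congr' ?_
    filter_upwards [hev ω] with n hn
    simp [hh, hn]
  simp only [integral_const, probReal_univ, smul_eq_mul, one_mul] at hlim
  filter_upwards [hlim.eventually_lt_const hs2', hle] with n hn hn2
  refine ⟨h n, hbi.mono' (hsm n) (Eventually.of_forall (hb n)), ?_, hn.le⟩
  filter_upwards [hn2] with ω hω
  simp only [hh]
  split_ifs with hc
  · exact (hℓ.mono hc).trans hs1.le
  · exact hω

/-- Slater's condition: subtracting a large constant pushes Y below x pointwise, while the heart
provides the integrable majorant θ(aX). -/
theorem exists_expLE_sub_const {ℓ : (Fin d → ℝ) → EReal} (hℓ : IsLossFunction ℓ)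
    {P : Measure Ω} [IsProbabilityMeasure P] {X : Ω → Fin d → ℝ} (hX : InHeart ℓ P X)
    {Y : Ω → Fin d → ℝ} (hY : Y ∈ dominated X) {x : Fin d → ℝ} {r : ℝ}
    (hx : ℓ x < (r : EReal)) :
    ∃ n : ℝ, ExpLE P (fun ω => ℓ (Y ω - fun _ => n)) r := by
  obtain ⟨hm, a, b, ha, hab⟩ := hY
  obtain ⟨r', T, hT, hTle, -⟩ := hX.2 a ha
  have := eventually_expLE hℓ (P := P) (Y := fun n ω => Y ω - fun _ => (n : ℝ))
    (fun n => hm.sub measurable_const) hT hx ?_ ?_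
  · obtain ⟨n, hn⟩ := this.exists
    exact ⟨n, hn⟩
  · filter_upwards [eventually_ge_atTop ⌈b⌉₊] with n hn
    filter_upwards [hTle] with ω hω
    refine le_trans (le_theta hℓ fun k => ?_) hω
    have h1 := hab ω k
    have h2 := le_abs_self (Y ω k)
    have h3 : b ≤ n := Nat.ceil_le.1 hn
    simp only [Pi.sub_apply, Pi.smul_apply, smul_eq_mul, abs_mul, abs_of_nonneg ha]
    linarith
  · intro ω
    have : ∀ k, ∀ᶠ n : ℕ in atTop, Y ω k - n ≤ x k := fun k => by
      filter_upwards [eventually_ge_atTop ⌈Y ω k - x k⌉₊] with n hn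
      have h3 : Y ω k - x k ≤ n := Nat.ceil_le.1 hn
      linarith
    filter_upwards [eventually_all.2 this] with n hn k using hn k

theorem self_mem_dominated {X : Ω → Fin d → ℝ} (hX : Measurable X) : X ∈ dominated X :=
  ⟨hX, 1, 0, zero_le_one, fun ω k => by simp⟩

theorem mem_dominated_of_bounded {X Y : Ω → Fin d → ℝ} (hY : Measurable Y) {b : ℝ}
    (h : ∀ ω k, |Y ω k| ≤ b) : Y ∈ dominated X :=
  ⟨hY, 0, b, le_rfl, fun ω k => by simpa using h ω k⟩

theorem const_mem_dominated (X : Ω → Fin d → ℝ) (m : Fin d → ℝ) :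
    (fun _ => m) ∈ dominated X :=
  mem_dominated_of_bounded measurable_const (b := ∑ k, |m k|) fun _ k =>
    Finset.single_le_sum (f := fun k => |m k|) (fun _ _ => abs_nonneg _) (Finset.mem_univ k)

theorem aemeasurable_loss {ℓ : (Fin d → ℝ) → EReal} (hℓ : IsLossFunction ℓ) {P : Measure Ω}
    {Y : Ω → Fin d → ℝ} (hY : AEMeasurable Y P) : AEMeasurable (fun ω => ℓ (Y ω)) P :=
  hℓ.measurable.comp_aemeasurable hY

theorem measurable_theta {ℓ : (Fin d → ℝ) → EReal} (hℓ : IsLossFunction ℓ) :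
    Measurable (theta ℓ) :=
  hℓ.measurable.comp (measurable_pi_iff.2 fun k => by
    simpa using (measurable_pi_apply k).abs)

/-- The growth condition gives the integrable minorant ∑ Y_k - c. -/
theorem expLE_loss_iff {ℓ : (Fin d → ℝ) → EReal} (hℓ : IsLossFunction ℓ) {P : Measure Ω}
    [IsProbabilityMeasure P] {Y : Ω → Fin d → ℝ} (hY : AEMeasurable Y P)
    (hi : ∀ k, Integrable (fun ω => Y ω k) P) {r : ℝ} :
    ExpLE P (fun ω => ℓ (Y ω)) r ↔ eexp P (fun ω => ℓ (Y ω)) ≤ (r : EReal) := by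
  obtain ⟨c, hc⟩ := hℓ.lower_bound
  refine ⟨ExpLE.eexp_le, fun h => expLE_of_eexp_le (g := fun ω => ∑ k, Y ω k - c)
    (aemeasurable_loss hℓ hY) ?_ (Eventually.of_forall fun ω => hc _) h⟩
  exact (integrable_finsetSum _ fun k _ => hi k).sub (integrable_const c)

/-! ### Lagrange duality by Riesz extension -/

/-- The convex cone of the `(Y, r, t)` with `t > 0` and `t E[ℓ (X + Y / t)] ≤ r`, and `0`. -/
def perspectiveCone {ℓ : (Fin d → ℝ) → EReal} (hℓ : IsLossFunction ℓ) (P : Measure Ω)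
    (X : Ω → Fin d → ℝ) : PointedCone ℝ (dominated X × ℝ × ℝ) where
  carrier := {p | p = 0 ∨ 0 < p.2.2 ∧
    ExpLE P (fun ω => ℓ (X ω + p.2.2⁻¹ • (p.1 : Ω → Fin d → ℝ) ω)) (p.2.2⁻¹ * p.2.1)}
  zero_mem' := Or.inl rfl
  smul_mem' := by
    rintro ⟨c, hc⟩ p (rfl | h)
    · exact Or.inl (smul_zero _)
    rcases hc.eq_or_lt with rfl | hc
    · exact Or.inl (zero_smul _ _)
    obtain ⟨Y, r, t⟩ := p
    obtain ⟨ht, h⟩ := h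
    simp only at ht h
    refine Or.inr ⟨mul_pos hc ht, h.mono (Eventually.of_forall fun ω => le_of_eq ?_)
      (le_of_eq ?_)⟩
    · congr 1
      ext k
      simp only [Nonneg.mk_smul, Prod.smul_mk, Submodule.coe_smul, Pi.smul_apply, smul_eq_mul,
        Pi.add_apply]
      field_simp
    · simp only [Nonneg.mk_smul, Prod.smul_mk, smul_eq_mul]
      field_simp
  add_mem' := by
    rintro p q (rfl | h) (rfl | h')
    · exact Or.inl (add_zero _)
    · rw [zero_add]; exact Or.inr h'
    · rw [add_zero]; exact Or.inr h
    obtain ⟨Y, r, t⟩ := p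
    obtain ⟨ht, h⟩ := h
    obtain ⟨Y', r', t'⟩ := q
    obtain ⟨ht', h'⟩ := h'
    simp only at ht h ht' h'
    have hs : 0 < t + t' := add_pos ht ht'
    have hc := h.convexComb hℓ (div_pos ht hs) (div_pos ht' hs)
      (by field_simp) h'
    refine Or.inr ⟨hs, hc.mono (Eventually.of_forall fun ω => le_of_eq ?_) (le_of_eq ?_)⟩
    · congr 1
      ext k
      simp only [Prod.mk_add_mk, Submodule.coe_add, Pi.add_apply, Pi.smul_apply, smul_eq_mul]
      field_simp
      ring
    · simp only [Prod.mk_add_mk]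
      field_simp

/-- A supporting functional for the shortfall risk, together with the multiplier of the
constraint `E[ℓ] ≤ 0`. -/
theorem exists_supporting_functional {ℓ : (Fin d → ℝ) → EReal} (hℓ : IsLossFunction ℓ)
    {P : Measure Ω} [IsProbabilityMeasure P] {X : Ω → Fin d → ℝ} (hX : InHeart ℓ P X) {ρ : ℝ}
    (hρ : ∀ m : Fin d → ℝ, ExpLE P (fun ω => ℓ (X ω - m)) 0 → ρ ≤ ∑ k, m k) :
    ∃ (ξ : dominated X →ₗ[ℝ] ℝ) (l : ℝ), 0 ≤ l ∧
      (∀ m : Fin d → ℝ, ξ ⟨fun _ => m, const_mem_dominated X m⟩ = ∑ k, m k) ∧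
      ∀ (Y : dominated X) (r : ℝ), ExpLE P (fun ω => ℓ ((Y : Ω → Fin d → ℝ) ω)) r →
        ξ Y - l * r ≤ ξ ⟨X, self_mem_dominated hX.1⟩ - ρ := by
  obtain ⟨ω₀⟩ := nonempty_of_isProbabilityMeasure P
  let D : Submodule ℝ (dominated X × ℝ × ℝ) :=
    { carrier := {p | p.2.1 = 0 ∧ ∃ m, ∀ ω, (p.1 : Ω → Fin d → ℝ) ω = m}
      zero_mem' := ⟨rfl, 0, fun _ => rfl⟩
      add_mem' := by
        rintro p q ⟨h, m, hm⟩ ⟨h', m', hm'⟩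
        exact ⟨by simp [h, h'], m + m', fun ω => by simp [hm ω, hm' ω]⟩
      smul_mem' := by
        rintro c p ⟨h, m, hm⟩
        exact ⟨by simp [h], c • m, fun ω => by simp [hm ω]⟩ }
  -- Evaluation at `ω₀` reads off the value of a constant vector. Only the restriction of `f₀` to
  -- `D` matters.
  let f₀ : (dominated X × ℝ × ℝ) →ₗ[ℝ] ℝ :=
    { toFun := fun p => -(∑ k, (p.1 : Ω → Fin d → ℝ) ω₀ k) - ρ * p.2.2
      map_add' := fun p q => by
        simp only [Prod.fst_add, Submodule.coe_add, Pi.add_apply, Finset.sum_add_distrib,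
          Prod.snd_add]
        ring
      map_smul' := fun c p => by
        simp only [Prod.smul_fst, Submodule.coe_smul, Pi.smul_apply, smul_eq_mul,
          ← Finset.mul_sum, Prod.smul_snd, RingHom.id_apply]
        ring }
  -- For a constant m, membership of (m, 0, t) with t > 0 says that -m/t is acceptable, so ρ ≤ -∑
  -- m_k / t by `hρ`.
  have hnonneg : ∀ x : (f₀.toPMap D).domain,
      (x : dominated X × ℝ × ℝ) ∈ perspectiveCone hℓ P X → 0 ≤ f₀.toPMap D x := ?_
  -- This is where Slater's condition enters: a constant shift and a large enough third coordinate
  -- bring every point into the cone.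
  have hdense : ∀ y, ∃ x : (f₀.toPMap D).domain,
      (x : dominated X × ℝ × ℝ) + y ∈ perspectiveCone hℓ P X := ?_
  · obtain ⟨g, hg1, hg2⟩ :=
      riesz_extension (perspectiveCone hℓ P X) (f₀.toPMap D) hnonneg hdense
    have hgc : ∀ (m : Fin d → ℝ) (t : ℝ),
        g (⟨fun _ => m, const_mem_dominated X m⟩, 0, t) = -(∑ k, m k) - ρ * t := fun m t =>
      hg1 ⟨(⟨fun _ => m, const_mem_dominated X m⟩, 0, t), rfl, m, fun _ => rfl⟩
    let ξ : dominated X →ₗ[ℝ] ℝ := -(g ∘ₗ LinearMap.inl ℝ (dominated X) (ℝ × ℝ))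
    have hξ : ∀ Y, ξ Y = -g (Y, 0, 0) := fun Y => rfl
    have hdec : ∀ Y r t, g (Y, r, t) = -ξ Y + r * g (0, 1, 0) - ρ * t := by
      intro Y r t
      have h1 : ((Y, r, t) : dominated X × ℝ × ℝ) = (Y, 0, 0) + r • (0, 1, 0) + (0, 0, t) := by
        simp
      have h2 : g (0, 0, t) = - ρ * t := by
        have := hgc 0 t
        simp only [Pi.zero_apply, Finset.sum_const_zero, neg_zero, zero_sub] at this
        rw [neg_mul, ← this]
        rfl
      rw [h1, map_add, map_add, map_smul, h2, hξ, smul_eq_mul]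
      ring
    have key : ∀ (Y : dominated X) (r : ℝ),
        ExpLE P (fun ω => ℓ ((Y : Ω → Fin d → ℝ) ω)) r →
        ξ Y - g (0, 1, 0) * r ≤ ξ ⟨X, self_mem_dominated hX.1⟩ - ρ := by
      intro Y r h
      have := hg2 (Y - ⟨X, self_mem_dominated hX.1⟩, r, 1)
        (Or.inr ⟨one_pos, by simpa using h⟩)
      rw [hdec, map_sub] at this
      linarith
    refine ⟨ξ, g (0, 1, 0), ?_, fun m => ?_, key⟩
    · obtain ⟨δ, x, -, hx⟩ := hℓ.exists_neg
      by_contra hl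
      push Not at hl
      set l := g (0, 1, 0)
      set γ := ξ ⟨X, self_mem_dominated hX.1⟩ - ρ
      set N := ξ ⟨fun _ => x, const_mem_dominated X x⟩
      -- Raising r keeps the bound E[ℓ(x)] ≤ r true, so a negative multiplier would make the left
      -- side of `key` exceed `γ`; this r already gives a contradiction.
      have := key ⟨fun _ => x, const_mem_dominated X x⟩ (max (-δ) ((γ - N + 1) / (-l)))
        (expLE_const (Eventually.of_forall fun ω => hx.le.trans (by
          exact_mod_cast le_max_left _ _)))
      have h2 := mul_le_mul_of_nonneg_left (le_max_right (-δ) ((γ - N + 1) / (-l)))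
        (neg_nonneg.2 hl.le)
      rw [mul_div_cancel₀ _ (by linarith : -l ≠ 0)] at h2
      linarith
    · rw [hξ, hgc]; ring
  · rintro ⟨Y, r, t⟩
    obtain ⟨δ, x, hδ, hx⟩ := hℓ.exists_neg
    -- Large enough that r / s ≥ -δ, the level reached by shifting X + Y / s down.
    set s := |r| / δ + 1
    have hs : 0 < s := by positivity
    have hsδ : -δ ≤ s⁻¹ * r := by
      rw [inv_mul_eq_div, le_div_iff₀ hs]
      have : δ * s = |r| + δ := by simp only [s]; field_simp
      have := neg_abs_le r
      linarith
    have hmem : X + s⁻¹ • (Y : Ω → Fin d → ℝ) ∈ dominated X :=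
      (dominated X).add_mem (self_mem_dominated hX.1) ((dominated X).smul_mem _ Y.2)
    obtain ⟨n, hn⟩ := exists_expLE_sub_const hℓ hX hmem hx
    refine ⟨⟨(⟨fun _ => fun _ => -(s * n), const_mem_dominated X _⟩, 0, s - t),
      rfl, _, fun _ => rfl⟩, Or.inr ⟨?_, ?_⟩⟩
    · simpa using hs
    · refine hn.mono (Eventually.of_forall fun ω => le_of_eq ?_) ?_
      · congr 1
        ext k
        simp only [Prod.mk_add_mk, Submodule.coe_add, Pi.add_apply, Pi.smul_apply, smul_eq_mul,
          Pi.sub_apply, sub_add_cancel]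
        field_simp
        ring
      · simpa using hsδ
  · rintro ⟨⟨Y, r, t⟩, hr, m, hm⟩ h
    rcases h with h | ⟨ht, h⟩
    · refine le_of_eq ?_
      change 0 = f₀ (Y, r, t)
      simp only at h
      rw [h, map_zero]
    simp only at hr hm ht h
    subst hr
    have := hρ (-(t⁻¹ • m)) (h.mono (Eventually.of_forall fun ω => by
      rw [hm ω, sub_neg_eq_add]) (by simp))
    have e : f₀.toPMap D ⟨(Y, 0, t), rfl, m, hm⟩ = -(∑ k, m k) - ρ * t := by
      change -(∑ k, (Y : Ω → Fin d → ℝ) ω₀ k) - ρ * t = _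
      rw [hm]
    rw [e]
    simp only [Pi.neg_apply, Pi.smul_apply, smul_eq_mul, Finset.sum_neg_distrib,
      ← Finset.mul_sum] at this
    have h3 := mul_le_mul_of_nonneg_left this ht.le
    have h4 : t * -(t⁻¹ * ∑ k, m k) = -∑ k, m k := by field_simp
    linarith

/-! ### Countably additive parts of finitely additive set functions -/

theorem additive_mono {m : Set Ω → ℝ} (hnn : ∀ A, MeasurableSet A → 0 ≤ m A)
    (hadd : ∀ A B, MeasurableSet A → MeasurableSet B → Disjoint A B → m (A ∪ B) = m A + m B)
    {A B : Set Ω} (hA : MeasurableSet A) (hB : MeasurableSet B) (h : A ⊆ B) : m A ≤ m B := by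
  have := hadd A (B \ A) hA (hB.diff hA) Set.disjoint_sdiff_right
  rw [Set.union_sdiff_cancel h] at this
  linarith [hnn _ (hB.diff hA)]

theorem additive_iUnion_finset_le {m : Set Ω → ℝ} (hnn : ∀ A, MeasurableSet A → 0 ≤ m A)
    (hadd : ∀ A B, MeasurableSet A → MeasurableSet B → Disjoint A B → m (A ∪ B) = m A + m B)
    {C : ℕ → Set Ω} (hC : ∀ n, MeasurableSet (C n)) (n : ℕ) :
    m (partialSups C n) ≤ ∑ i ∈ Finset.range (n + 1), m (C i) ∧
      MeasurableSet (partialSups C n) := by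
  induction n with
  | zero => simpa using hC 0
  | succ n ih =>
    rw [partialSups_add_one, Finset.sum_range_succ]
    change m (partialSups C n ∪ C (n + 1)) ≤ _ ∧ MeasurableSet (partialSups C n ∪ C (n + 1))
    refine ⟨?_, ih.2.union (hC _)⟩
    rw [← Set.union_sdiff_self, hadd _ _ ih.2 ((hC _).diff ih.2) Set.disjoint_sdiff_right]
    have := additive_mono hnn hadd ((hC (n + 1)).diff ih.2) (hC _) Set.sdiff_subset
    linarith [ih.1]

/-- The countably additive part of a nonnegative finitely additive set function: it is dominated
by the set function, and exhausted by sets on which the remainder is small. -/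
theorem exists_countablyAdditive_part (m : Set Ω → ℝ) (hnn : ∀ A, MeasurableSet A → 0 ≤ m A)
    (hadd : ∀ A B, MeasurableSet A → MeasurableSet B → Disjoint A B → m (A ∪ B) = m A + m B) :
    ∃ ν : Measure Ω, (∀ A, MeasurableSet A → ν A ≤ ENNReal.ofReal (m A)) ∧
      ∀ ε : ℝ, 0 < ε → ∃ D : ℕ → Set Ω, Monotone D ∧ (∀ n, MeasurableSet (D n)) ∧
        ⋃ n, D n = Set.univ ∧ ∀ n, m (D n) ≤ ν.real Set.univ + ε := by
  have h0 : m ∅ = 0 := by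
    have := hadd ∅ ∅ .empty .empty (disjoint_bot_left)
    rw [Set.union_empty] at this
    linarith
  let m' : ∀ A : Set Ω, MeasurableSet A → ENNReal := fun A _ => ENNReal.ofReal (m A)
  have hm0 : m' ∅ MeasurableSet.empty = 0 := by simp [m', h0]
  set μ : OuterMeasure Ω := inducedOuterMeasure m' MeasurableSet.empty hm0 with hμ
  have hcar : ‹MeasurableSpace Ω› ≤ μ.caratheodory := by
    intro s hs
    -- The splitting inequality is needed only for the set function that generates the outer
    -- measure. It is infinite off the measurable sets, and finite additivity gives equality on
    -- them.
    refine OuterMeasure.ofFunction_caratheodory fun t => ?_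
    by_cases ht : MeasurableSet t
    · rw [extend_eq _ ht, extend_eq _ (ht.inter hs), extend_eq _ (ht.diff hs),
        ← ENNReal.ofReal_add (hnn _ (ht.inter hs)) (hnn _ (ht.diff hs)),
        ← hadd _ _ (ht.inter hs) (ht.diff hs)
          (Set.disjoint_sdiff_right.mono_left Set.inter_subset_right), Set.inter_union_sdiff]
    · rw [extend_eq_top _ ht]; exact le_top
  have hle : ∀ A, MeasurableSet A → μ.toMeasure hcar A ≤ ENNReal.ofReal (m A) := by
    intro A hA
    rw [toMeasure_apply _ _ hA]
    refine (OuterMeasure.ofFunction_le A).trans ?_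
    rw [extend_eq _ hA]
  have hfin : μ.toMeasure hcar Set.univ ≠ ⊤ :=
    ((hle _ .univ).trans_lt ENNReal.ofReal_lt_top).ne
  refine ⟨μ.toMeasure hcar, hle, fun ε hε => ?_⟩
  have hlt : μ Set.univ < μ.toMeasure hcar Set.univ + ENNReal.ofReal ε := by
    rw [← toMeasure_apply _ hcar .univ]
    exact ENNReal.lt_add_right hfin (by simpa using hε)
  have hinf : μ Set.univ = ⨅ (t : ℕ → Set Ω) (_ : ∀ i, MeasurableSet (t i))
      (_ : Set.univ ⊆ ⋃ i, t i), ∑' i, extend m' (t i) :=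
    OuterMeasure.ofFunction_eq_iInf_mem _ _ (fun s hs => extend_eq_top _ hs) _
  rw [hinf] at hlt
  simp only [iInf_lt_iff] at hlt
  -- A near-optimal countable cover of the whole space. Its finite unions are the exhausting sets,
  -- and subadditivity of `m` bounds them by the cover's total.
  obtain ⟨C, hC, hcov, hsum⟩ := hlt
  refine ⟨partialSups C, (partialSups C).monotone,
    fun n => (additive_iUnion_finset_le hnn hadd hC n).2, ?_, fun n => ?_⟩
  · refine Set.univ_subset_iff.1 (hcov.trans ?_)
    exact Set.iUnion_mono fun n => le_partialSups C n
  · refine (additive_iUnion_finset_le hnn hadd hC n).1.trans ?_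
    have h1 := (ENNReal.sum_le_tsum (Finset.range (n + 1))).trans hsum.le
    have h2 : ∑ i ∈ Finset.range (n + 1), extend m' (C i) =
        ENNReal.ofReal (∑ i ∈ Finset.range (n + 1), m (C i)) := by
      rw [ENNReal.ofReal_sum_of_nonneg fun i _ => hnn _ (hC i)]
      exact Finset.sum_congr rfl fun i _ => extend_eq _ (hC i)
    rw [h2] at h1
    have h3 := ENNReal.toReal_mono (ENNReal.add_ne_top.2 ⟨hfin, ENNReal.ofReal_ne_top⟩) h1
    rwa [ENNReal.toReal_ofReal (Finset.sum_nonneg fun i _ => hnn _ (hC i)),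
      ENNReal.toReal_add hfin ENNReal.ofReal_ne_top, ENNReal.toReal_ofReal hε.le] at h3

/-- Densities of the countably additive parts of finitely many finitely additive set functions,
with a common sequence of sets along which the remainders disappear. -/
theorem exists_density_of_additive {P : Measure Ω} [IsProbabilityMeasure P]
    (m : Fin d → Set Ω → ℝ) (hnn : ∀ k A, MeasurableSet A → 0 ≤ m k A)
    (hadd : ∀ k A B, MeasurableSet A → MeasurableSet B → Disjoint A B →
      m k (A ∪ B) = m k A + m k B)
    (hac : ∀ k A, MeasurableSet A → P A = 0 → m k A = 0) :
    ∃ (Z : Ω → Fin d → ℝ) (B : ℕ → Set Ω), Measurable Z ∧ (∀ ω k, 0 ≤ Z ω k) ∧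
      (∀ k, Integrable (fun ω => Z ω k) P) ∧ (∀ n, MeasurableSet (B n)) ∧
      (∀ k A, MeasurableSet A → ∫ ω in A, Z ω k ∂P ≤ m k A) ∧
      (∀ k A, MeasurableSet A →
        Tendsto (fun n => m k (A ∩ B n)) atTop (𝓝 (∫ ω in A, Z ω k ∂P))) ∧
      ∀ A, MeasurableSet A → Tendsto (fun n => P.real (A ∩ B n)) atTop (𝓝 (P.real A)) := by
  choose ν hν hD using fun k => exists_countablyAdditive_part (m k) (hnn k) (hadd k)
  have hfin : ∀ k, IsFiniteMeasure (ν k) := fun k =>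
    ⟨(hν k _ .univ).trans_lt ENNReal.ofReal_lt_top⟩
  have hνac : ∀ k, ν k ≪ P := fun k => Measure.AbsolutelyContinuous.mk fun A hA h => by
    have := hν k A hA
    rw [hac k A hA h] at this
    simpa using this
  have hνm : ∀ k A, MeasurableSet A → (ν k).real A ≤ m k A := fun k A hA =>
    ENNReal.toReal_le_of_le_ofReal (hnn k A hA) (hν k A hA)
  have hB : ∀ ε : ℝ, 0 < ε → ∃ B, MeasurableSet B ∧ P.real Bᶜ ≤ ε ∧
      ∀ k, (ν k).real Bᶜ ≤ ε ∧ m k B ≤ (ν k).real Set.univ + ε := by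
    intro ε hε
    choose D hDmono hDmeas hDcov hDle using fun k => hD k ε hε
    have hEmeas : ∀ n, MeasurableSet (⋂ k, D k n) := fun n => .iInter fun k => hDmeas k n
    have hlim : ∀ (μ : Measure Ω) [IsFiniteMeasure μ],
        Tendsto (fun n => μ.real (⋂ k, D k n)ᶜ) atTop (𝓝 0) := by
      intro μ _
      have hanti : Antitone fun n => (⋂ k, D k n)ᶜ := fun a b hab =>
        Set.compl_subset_compl.2 (Set.iInter_mono fun k => hDmono k hab)
      have hempty : ⋂ n, (⋂ k, D k n)ᶜ = ∅ := by
        rw [← Set.compl_iUnion, Set.compl_empty_iff, Set.eq_univ_iff_forall]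
        intro ω
        have : ∀ k, ∀ᶠ n in atTop, ω ∈ D k n := fun k => by
          have hω : ω ∈ ⋃ n, D k n := by rw [hDcov k]; trivial
          obtain ⟨n, hn⟩ := Set.mem_iUnion.1 hω
          filter_upwards [eventually_ge_atTop n] with n' h' using hDmono k h' hn
        obtain ⟨n, hn⟩ := (eventually_all.2 this).exists
        exact Set.mem_iUnion.2 ⟨n, Set.mem_iInter.2 hn⟩
      have := tendsto_measure_iInter_atTop (μ := μ)
        (fun n => (hEmeas n).compl.nullMeasurableSet) hanti ⟨0, measure_ne_top _ _⟩
      rw [hempty, measure_empty] at this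
      exact (ENNReal.tendsto_toReal ENNReal.zero_ne_top).comp this
    have h1 := (hlim P).eventually_le_const hε
    have h2 : ∀ᶠ n in atTop, ∀ k, (ν k).real (⋂ k, D k n)ᶜ ≤ ε :=
      eventually_all.2 fun k => (hlim (ν k)).eventually_le_const hε
    obtain ⟨n, hn1, hn2⟩ := (h1.and h2).exists
    exact ⟨_, hEmeas n, hn1, fun k => ⟨hn2 k, (additive_mono (hnn k) (hadd k) (hEmeas n)
      (hDmeas k n) (Set.iInter_subset _ k)).trans (hDle k n)⟩⟩
  -- The sets `B n` need not increase; what matters is that all the errors on them are at most 1 /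
  -- (n + 1).
  choose B hBm hBP hBν using fun n : ℕ => hB (1 / ((n : ℝ) + 1)) (by positivity)
  have hZ : ∀ k A, ∫ ω in A, ((ν k).rnDeriv P ω).toReal ∂P = (ν k).real A := fun k A =>
    Measure.setIntegral_toReal_rnDeriv (hνac k) A
  have hsplit : ∀ (μ : Measure Ω) [IsFiniteMeasure μ] (A : Set Ω) (n : ℕ),
      μ.real A ≤ μ.real (A ∩ B n) + μ.real (B n)ᶜ := fun μ _ A n => by
    refine le_trans (measureReal_mono (s₂ := A ∩ B n ∪ (B n)ᶜ) fun ω hω => ?_)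
      (measureReal_union_le _ _)
    by_cases h : ω ∈ B n
    · exact Or.inl ⟨hω, h⟩
    · exact Or.inr h
  have h0 := tendsto_one_div_add_atTop_nhds_zero_nat (𝕜 := ℝ)
  refine ⟨fun ω k => ((ν k).rnDeriv P ω).toReal, B,
    measurable_pi_iff.2 fun k => (Measure.measurable_rnDeriv _ _).ennreal_toReal,
    fun _ _ => ENNReal.toReal_nonneg, fun k => Measure.integrable_toReal_rnDeriv, hBm,
    fun k A hA => (hZ k A).trans_le (hνm k A hA), fun k A hA => ?_, fun A hA => ?_⟩
  · rw [hZ]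
    -- The upper error is doubled because m(A ∩ B) = m(B) - m(Aᶜ ∩ B): one error bounds m(B) by
    -- ν(Ω), the other replaces ν(Aᶜ ∩ B) by ν(Aᶜ).
    refine tendsto_of_tendsto_of_tendsto_of_le_of_le (g := fun n : ℕ => (ν k).real A - 1 / (n + 1))
      (h := fun n : ℕ => (ν k).real A + 2 * (1 / (n + 1)))
      (by simpa using h0.const_sub ((ν k).real A))
      (by simpa using (h0.const_mul 2).const_add ((ν k).real A)) (fun n => ?_) fun n => ?_
    · have h1 := hsplit (ν k) A n
      have h2 := hνm k _ (hA.inter (hBm n))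
      have h3 := (hBν n k).1
      simp only
      linarith
    · have h1 := hsplit (ν k) Aᶜ n
      have h2 := hνm k _ (hA.compl.inter (hBm n))
      have h3 := hBν n k
      have h4 := hadd k _ _ (hA.inter (hBm n)) (hA.compl.inter (hBm n))
        (disjoint_compl_right.mono Set.inter_subset_left Set.inter_subset_left)
      rw [← Set.union_inter_distrib_right, Set.union_compl_self, Set.univ_inter] at h4
      have h5 := measureReal_add_measureReal_compl (μ := ν k) hA
      simp only
      linarith
  · refine tendsto_of_tendsto_of_tendsto_of_le_of_le (g := fun n : ℕ => P.real A - 1 / (n + 1))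
      (by simpa using h0.const_sub (P.real A)) tendsto_const_nhds (fun n => ?_) fun n => ?_
    · have h1 := hsplit P A n
      have h2 := hBP n
      simp only
      linarith
    · exact measureReal_mono Set.inter_subset_left

/-! ### Densities of supporting functionals -/

/-- `ξ` and the multiplier `l` satisfy `ξ Y - l E[ℓ Y] ≤ γ` for all `Y`, and `ξ` is the sum of the
coordinates on constants. -/
structure IsSupporting (ℓ : (Fin d → ℝ) → EReal) (P : Measure Ω) (X : Ω → Fin d → ℝ)
    (ξ : dominated X →ₗ[ℝ] ℝ) (l γ : ℝ) : Prop where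
  nonneg : 0 ≤ l
  const : ∀ m : Fin d → ℝ, ξ ⟨fun _ => m, const_mem_dominated X m⟩ = ∑ k, m k
  le : ∀ (Y : dominated X) (r : ℝ), ExpLE P (fun ω => ℓ ((Y : Ω → Fin d → ℝ) ω)) r →
    ξ Y - l * r ≤ γ

/-- The vector `v` on `A`, and `0` elsewhere. -/
noncomputable def onSet (X : Ω → Fin d → ℝ) {A : Set Ω} (hA : MeasurableSet A)
    (v : Fin d → ℝ) : dominated X :=
  ⟨A.indicator fun _ => v, mem_dominated_of_bounded (measurable_const.indicator hA)
    (b := ∑ k, |v k|) fun ω k => by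
      have h : |v k| ≤ ∑ k, |v k| :=
        Finset.single_le_sum (f := fun k => |v k|) (fun _ _ => abs_nonneg _) (Finset.mem_univ k)
      by_cases hω : ω ∈ A
      · simpa [hω] using h
      · simpa [hω] using (abs_nonneg _).trans h⟩

theorem onSet_apply (X : Ω → Fin d → ℝ) {A : Set Ω} (hA : MeasurableSet A) (v : Fin d → ℝ)
    (ω : Ω) : (onSet X hA v : Ω → Fin d → ℝ) ω = A.indicator (fun _ => v) ω := rfl

theorem map_onSet {X : Ω → Fin d → ℝ} (ξ : dominated X →ₗ[ℝ] ℝ) {A : Set Ω}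
    (hA : MeasurableSet A) (v : Fin d → ℝ) :
    ξ (onSet X hA v) = ∑ k, v k * ξ (onSet X hA (Pi.single k 1)) := by
  have : onSet X hA v = ∑ k, v k • onSet X hA (Pi.single k 1) := by
    ext ω j
    simp only [Submodule.coe_sum, Submodule.coe_smul, Finset.sum_apply, Pi.smul_apply,
      smul_eq_mul, onSet_apply]
    by_cases hω : ω ∈ A <;> simp [hω, Pi.single_apply]
  rw [this, map_sum]
  simp

namespace IsSupporting

variable {ℓ : (Fin d → ℝ) → EReal} {P : Measure Ω} {X : Ω → Fin d → ℝ}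
  {ξ : dominated X →ₗ[ℝ] ℝ} {l γ : ℝ}

/-- Subtracting nY from a point x of finite loss can only lower the loss, but would raise ξ without
bound if ξ(Y) < 0. -/
theorem map_nonneg [IsProbabilityMeasure P] (h : IsSupporting ℓ P X ξ l γ)
    (hℓ : IsLossFunction ℓ) {Y : dominated X}
    (hY : ∀ᵐ ω ∂P, 0 ≤ (Y : Ω → Fin d → ℝ) ω) : 0 ≤ ξ Y := by
  obtain ⟨δ, x, -, hx⟩ := hℓ.exists_neg
  by_contra hneg
  push Not at hneg
  have key : ∀ n : ℕ, ∑ k, x k - n * ξ Y - l * -δ ≤ γ := by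
    intro n
    have := h.le (⟨fun _ => x, const_mem_dominated X x⟩ - (n : ℝ) • Y) (-δ) (expLE_const (by
      filter_upwards [hY] with ω hω
      refine (hℓ.mono fun k => ?_).trans hx.le
      have h1 : 0 ≤ (n : ℝ) * (Y : Ω → Fin d → ℝ) ω k := mul_nonneg n.cast_nonneg (hω k)
      simpa using h1))
    rwa [map_sub, map_smul, h.const, smul_eq_mul] at this
  obtain ⟨n, hn⟩ := exists_nat_gt ((γ - ∑ k, x k + l * -δ) / (-ξ Y))
  rw [div_lt_iff₀ (by linarith)] at hn
  have := key n
  linarith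

theorem map_eq_zero [IsProbabilityMeasure P] (h : IsSupporting ℓ P X ξ l γ)
    (hℓ : IsLossFunction ℓ) {Y : dominated X}
    (hY : ∀ᵐ ω ∂P, (Y : Ω → Fin d → ℝ) ω = 0) : ξ Y = 0 := by
  have h1 := h.map_nonneg hℓ (hY.mono fun ω hω => hω.ge)
  have h2 := h.map_nonneg hℓ (Y := -Y) (hY.mono fun ω hω => by simp [hω])
  rw [map_neg] at h2
  linarith

/-- The density of the countably additive part of a supporting functional, and the effect of the
remainder. -/
theorem exists_density [IsProbabilityMeasure P] (h : IsSupporting ℓ P X ξ l γ)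
    (hℓ : IsLossFunction ℓ) :
    ∃ Z : Ω → Fin d → ℝ, Measurable Z ∧ (∀ ω k, 0 ≤ Z ω k) ∧
      (∀ k, Integrable (fun ω => Z ω k) P) ∧ (∀ k, ∫ ω, Z ω k ∂P ≤ 1) ∧
      (∀ k, ∫ ω, Z ω k ∂P = 1 → ∀ A (hA : MeasurableSet A),
        ξ (onSet X hA (Pi.single k 1)) = ∫ ω in A, Z ω k ∂P) ∧
      ∀ (x : ℕ → Fin d → ℝ) (r : ℕ → ℝ), (∀ i, ℓ (x i) ≤ (r i : EReal)) →
        ∀ (x₀ : Fin d → ℝ) (r₀ : ℝ), ℓ x₀ ≤ (r₀ : EReal) → ∀ (ι : Ω → ℕ) (N : ℕ),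
          Measurable ι → (∀ ω, ι ω ≤ N) →
          Integrable (fun ω => ∑ k, x (ι ω) k * Z ω k - l * r (ι ω)) P ∧
          ∫ ω, (∑ k, x (ι ω) k * Z ω k - l * r (ι ω)) ∂P +
            ∑ k, x₀ k * (1 - ∫ ω, Z ω k ∂P) ≤ γ := by
  classical
  -- The value 0 on nonmeasurable sets is a default that plays no role.
  let m : Fin d → Set Ω → ℝ := fun k A =>
    if hA : MeasurableSet A then ξ (onSet X hA (Pi.single k 1)) else 0
  have hm : ∀ k A (hA : MeasurableSet A), m k A = ξ (onSet X hA (Pi.single k 1)) :=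
    fun k A hA => dif_pos hA
  have hnn : ∀ k A, MeasurableSet A → 0 ≤ m k A := fun k A hA => by
    rw [hm k A hA]
    refine h.map_nonneg hℓ (Eventually.of_forall fun ω => ?_)
    rw [onSet_apply]
    exact Set.indicator_nonneg (fun _ _ => Pi.single_nonneg.2 zero_le_one) ω
  have hadd : ∀ k A B, MeasurableSet A → MeasurableSet B → Disjoint A B →
      m k (A ∪ B) = m k A + m k B := fun k A B hA hB hAB => by
    rw [hm k A hA, hm k B hB, hm k _ (hA.union hB), ← map_add]
    congr 1
    ext1
    exact Set.indicator_union_of_disjoint hAB _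
  have hac : ∀ k A, MeasurableSet A → P A = 0 → m k A = 0 := fun k A hA h0 => by
    rw [hm k A hA]
    refine h.map_eq_zero hℓ ?_
    filter_upwards [measure_eq_zero_iff_ae_notMem.1 h0] with ω hω
    simp [onSet_apply, hω]
  have huniv : ∀ k, m k Set.univ = 1 := fun k => by
    rw [hm k _ .univ]
    have := h.const (Pi.single k 1)
    rw [Finset.sum_pi_single' k (1 : ℝ) Finset.univ] at this
    simp only [Finset.mem_univ, if_true] at this
    refine Eq.trans (congrArg ξ (Subtype.ext ?_)) this
    exact Set.indicator_univ _
  obtain ⟨Z, B, hZm, hZ0, hZi, hBm, hle, hlim, hPlim⟩ :=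
    exists_density_of_additive (P := P) m hnn hadd hac
  refine ⟨Z, hZm, hZ0, hZi, fun k => ?_, fun k hk A hA => ?_, ?_⟩
  · simpa [huniv] using hle k _ .univ
  -- The integral of Z_k is at most the set function on both A and its complement, and the totals
  -- agree, so neither inequality is strict.
  · rw [← hm k A hA]
    have h1 := hle k A hA
    have h2 := hle k _ hA.compl
    have h3 := hadd k A Aᶜ hA hA.compl disjoint_compl_right
    rw [Set.union_compl_self, huniv] at h3
    have h4 := integral_add_compl hA (hZi k)
    linarith
  · intro x r hxr x₀ r₀ hx₀ ι N hι hιN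
    have hAm : ∀ i, MeasurableSet (ι ⁻¹' {i}) := fun i => hι (measurableSet_singleton i)
    have hsum : ∀ {E : Type} [AddCommMonoid E] (f : ℕ → E) (ω : Ω),
        ∑ i ∈ Finset.range (N + 1), (ι ⁻¹' {i}).indicator (fun _ => f i) ω = f (ι ω) := by
      intro E _ f ω
      rw [Finset.sum_eq_single (ι ω)]
      · simp
      · intro i _ hi
        exact Set.indicator_of_notMem (fun hmem => hi (by simpa using hmem.symm)) _
      · intro hnot
        exact absurd (Finset.mem_range.2 (Nat.lt_succ_of_le (hιN ω))) hnot
    have hsumB : ∀ {E : Type} [AddCommMonoid E] (f : ℕ → E) (e : E) (n : ℕ) (ω : Ω),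
        ∑ i ∈ Finset.range (N + 1), (ι ⁻¹' {i} ∩ B n).indicator (fun _ => f i) ω +
          (B n)ᶜ.indicator (fun _ => e) ω = if ω ∈ B n then f (ι ω) else e := by
      intro E _ f e n ω
      by_cases hω : ω ∈ B n
      · rw [if_pos hω, Set.indicator_of_notMem (by simpa using hω), add_zero, ← hsum f ω]
        refine Finset.sum_congr rfl fun i _ => ?_
        by_cases hi : ω ∈ ι ⁻¹' {i} <;> simp [Set.indicator, hω]
      · rw [if_neg hω, Set.indicator_of_mem (by simpa using hω)]
        rw [Finset.sum_eq_zero fun i _ => Set.indicator_of_notMem (fun hh => hω hh.2) _, zero_add]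
    -- The test vector is x(ι) on `B n` and x₀ off it. In the limit the loss r₀ off `B n` costs
    -- nothing, while x₀ is paired with the whole mass missing from Z.
    have htest : ∀ n, ∑ i ∈ Finset.range (N + 1), (∑ k, x i k * m k (ι ⁻¹' {i} ∩ B n) -
        l * (r i * P.real (ι ⁻¹' {i} ∩ B n))) +
        (∑ k, x₀ k * (1 - m k (B n)) - l * (r₀ * (1 - P.real (B n)))) ≤ γ := by
      intro n
      have hAB : ∀ i, MeasurableSet (ι ⁻¹' {i} ∩ B n) := fun i => (hAm i).inter (hBm n)
      let W : dominated X := ∑ i ∈ Finset.range (N + 1), onSet X (hAB i) (x i) +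
        onSet X (hBm n).compl x₀
      have hW : ∀ ω, (W : Ω → Fin d → ℝ) ω = if ω ∈ B n then x (ι ω) else x₀ := by
        intro ω
        rw [← hsumB x x₀ n ω]
        simp only [W, Submodule.coe_add, Submodule.coe_sum, Pi.add_apply, Finset.sum_apply,
          onSet_apply]
      have hξW : ξ W = ∑ i ∈ Finset.range (N + 1), ∑ k, x i k * m k (ι ⁻¹' {i} ∩ B n) +
          ∑ k, x₀ k * (1 - m k (B n)) := by
        simp only [W, map_add, map_sum]
        congr 1
        · refine Finset.sum_congr rfl fun i _ => ?_
          rw [map_onSet]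
          exact Finset.sum_congr rfl fun k _ => by rw [hm k _ (hAB i)]
        · rw [map_onSet]
          refine Finset.sum_congr rfl fun k _ => ?_
          have := hadd k _ _ (hBm n) (hBm n).compl disjoint_compl_right
          rw [Set.union_compl_self, huniv] at this
          rw [← hm k _ (hBm n).compl, this]
          ring
      have hE : ExpLE P (fun ω => ℓ ((W : Ω → Fin d → ℝ) ω))
          (∑ i ∈ Finset.range (N + 1), r i * P.real (ι ⁻¹' {i} ∩ B n) +
            r₀ * (1 - P.real (B n))) := by
        have hi : ∀ i, Integrable ((ι ⁻¹' {i} ∩ B n).indicator fun _ => r i) P := fun i =>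
          (integrable_const _).indicator (hAB i)
        have hi₀ : Integrable ((B n)ᶜ.indicator fun _ => r₀) P :=
          (integrable_const _).indicator (hBm n).compl
        refine ⟨fun ω => ∑ i ∈ Finset.range (N + 1),
          (ι ⁻¹' {i} ∩ B n).indicator (fun _ => r i) ω + (B n)ᶜ.indicator (fun _ => r₀) ω,
          (integrable_finsetSum _ fun i _ => hi i).add hi₀,
          Eventually.of_forall fun ω => ?_, ?_⟩
        · simp only [hW, hsumB]
          split_ifs
          · exact hxr _
          · exact hx₀
        · rw [integral_add (integrable_finsetSum _ fun i _ => hi i) hi₀,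
            integral_finsetSum _ fun i _ => hi i, integral_indicator (hBm n).compl]
          have h1 := measureReal_add_measureReal_compl (μ := P) (hBm n)
          rw [probReal_univ] at h1
          refine le_of_eq ?_
          congr 1
          · refine Finset.sum_congr rfl fun i _ => ?_
            rw [integral_indicator (hAB i), setIntegral_const, smul_eq_mul, mul_comm]
          · rw [setIntegral_const, smul_eq_mul, mul_comm, ← h1]
            ring
      have := h.le W _ hE
      rw [hξW] at this
      refine le_trans (le_of_eq ?_) this
      rw [Finset.sum_sub_distrib, ← Finset.mul_sum]
      ring
    have hpt : ∀ ω, ∑ k, x (ι ω) k * Z ω k - l * r (ι ω) = ∑ i ∈ Finset.range (N + 1),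
        (ι ⁻¹' {i}).indicator (fun ω => ∑ k, x i k * Z ω k - l * r i) ω := by
      intro ω
      rw [← hsum (fun i => ∑ k, x i k * Z ω k - l * r i) ω]
      exact Finset.sum_congr rfl fun i _ => rfl
    have hint : ∀ i, Integrable (fun ω => ∑ k, x i k * Z ω k - l * r i) P := fun i =>
      (integrable_finsetSum _ fun k _ => (hZi k).const_mul _).sub (integrable_const _)
    have hintι : Integrable (fun ω => ∑ k, x (ι ω) k * Z ω k - l * r (ι ω)) P := by
      simp only [hpt]
      exact integrable_finsetSum _ fun i _ => (hint i).indicator (hAm i)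
    have hval : ∫ ω, (∑ k, x (ι ω) k * Z ω k - l * r (ι ω)) ∂P =
        ∑ i ∈ Finset.range (N + 1), (∑ k, x i k * (∫ ω in ι ⁻¹' {i}, Z ω k ∂P) -
          l * (r i * P.real (ι ⁻¹' {i}))) := by
      simp only [hpt]
      rw [integral_finsetSum _ fun i _ => (hint i).indicator (hAm i)]
      refine Finset.sum_congr rfl fun i _ => ?_
      have hk : ∀ k, IntegrableOn (fun ω => x i k * Z ω k) (ι ⁻¹' {i}) P := fun k =>
        ((hZi k).const_mul _).integrableOn
      rw [integral_indicator (hAm i), integral_sub (integrable_finsetSum _ fun k _ => hk k)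
        (integrable_const _), integral_finsetSum _ fun k _ => hk k, setIntegral_const]
      simp only [integral_const_mul, smul_eq_mul]
      ring
    refine ⟨hintι, ?_⟩
    rw [hval]
    refine le_of_tendsto' (x := (atTop : Filter ℕ)) ?_ htest
    have hm1 : ∀ k, Tendsto (fun n => m k (B n)) atTop (𝓝 (∫ ω, Z ω k ∂P)) := fun k => by
      simpa using hlim k _ .univ
    have hP1 : Tendsto (fun n => P.real (B n)) atTop (𝓝 1) := by
      simpa using hPlim _ .univ
    refine Tendsto.add (tendsto_finsetSum _ fun i _ => Tendsto.sub
      (tendsto_finsetSum _ fun k _ => (hlim k _ (hAm i)).const_mul _)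
      (((hPlim _ (hAm i)).const_mul _).const_mul _)) ?_
    have := (tendsto_finsetSum Finset.univ fun k _ => ((hm1 k).const_sub 1).const_mul (x₀ k)).sub
      (((hP1.const_sub 1).const_mul r₀).const_mul l)
    simpa using this

end IsSupporting

/-! ### The conjugate as a countable supremum, and Fenchel's inequality -/

theorem IsLossFunction.exists_real {ℓ : (Fin d → ℝ) → EReal} (hℓ : IsLossFunction ℓ)
    {x : Fin d → ℝ} (hx : ℓ x < ⊤) : ∃ r : ℝ, ℓ x = (r : EReal) :=
  ⟨(ℓ x).toReal, (EReal.coe_toReal hx.ne (hℓ.ne_bot x)).symm⟩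

theorem mul_conj_le {f : (Fin d → ℝ) → EReal} {l : ℝ} (hl : 0 < l) {y : Fin d → ℝ} {S : EReal}
    (hf : ∀ x, f x ≠ ⊥)
    (h : ∀ (x : Fin d → ℝ) (r : ℝ), f x = (r : EReal) →
      ((∑ k, x k * y k - l * r : ℝ) : EReal) ≤ S) :
    (l : EReal) * conj f (l⁻¹ • y) ≤ S := by
  have hl' : (0 : EReal) < l := by exact_mod_cast hl
  rw [mul_comm, ← EReal.le_div_iff_mul_le hl' (EReal.coe_ne_top l)]
  refine iSup_le fun x => ?_
  rw [EReal.le_div_iff_mul_le hl' (EReal.coe_ne_top l)]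
  by_cases htop : f x = ⊤
  · rw [htop, EReal.sub_top, EReal.bot_mul_of_pos hl']
    exact bot_le
  · have hr := EReal.coe_toReal htop (hf x)
    refine le_trans (le_of_eq ?_) (h x _ hr.symm)
    rw [← hr, ← EReal.coe_sub, ← EReal.coe_mul, EReal.toReal_coe]
    congr 1
    simp only [Pi.smul_apply, smul_eq_mul]
    rw [sub_mul, Finset.sum_mul, mul_comm l]
    congr 1
    refine Finset.sum_congr rfl fun k _ => ?_
    field_simp

/-- The conjugate as the supremum of a sequence of affine functions. -/
theorem exists_seq_conj_le {ℓ : (Fin d → ℝ) → EReal} (hℓ : IsLossFunction ℓ) :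
    ∃ (x : ℕ → Fin d → ℝ) (r : ℕ → ℝ), (∀ i, ℓ (x i) ≤ (r i : EReal)) ∧
      ∀ (l : ℝ) (y : Fin d → ℝ), 0 < l →
        (l : EReal) * conj ℓ (l⁻¹ • y) ≤ ⨆ i, ((∑ k, x i k * y k - l * r i : ℝ) : EReal) := by
  -- A dense sequence is taken in the epigraph rather than in the domain: the affine expression is
  -- continuous in (x, r), whereas ℓ need not be continuous. The sequence then serves all `l` and
  -- `y` at once.
  let epi : Set ((Fin d → ℝ) × ℝ) := {p | ℓ p.1 ≤ (p.2 : EReal)}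
  obtain ⟨δ, x₀, -, hx₀⟩ := hℓ.exists_neg
  have : Nonempty epi := ⟨⟨(x₀, -δ), hx₀.le⟩⟩
  let u := TopologicalSpace.denseSeq epi
  refine ⟨fun i => (u i).1.1, fun i => (u i).1.2, fun i => (u i).2, fun l y hl => ?_⟩
  refine mul_conj_le hl hℓ.ne_bot fun x r hxr => ?_
  by_contra hlt
  obtain ⟨q, hq1, hq2⟩ := EReal.lt_iff_exists_real_btwn.1 (not_le.1 hlt)
  have hcont : Continuous fun p : epi => ∑ k, p.1.1 k * y k - l * p.1.2 := by fun_prop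
  have hopen : IsOpen {p : epi | q < ∑ k, p.1.1 k * y k - l * p.1.2} :=
    isOpen_lt continuous_const hcont
  obtain ⟨i, hi⟩ := (TopologicalSpace.denseRange_denseSeq epi).exists_mem_open hopen
    ⟨⟨(x, r), hxr.le⟩, by exact_mod_cast hq2⟩
  have h1 : (q : EReal) < ((∑ k, (u i).1.1 k * y k - l * (u i).1.2 : ℝ) : EReal) := by
    exact_mod_cast hi
  exact absurd (h1.trans_le (le_iSup (fun i => ((∑ k, (u i).1.1 k * y k - l * (u i).1.2 : ℝ) :
    EReal)) i)) hq1.le.not_gt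

/-- A measurable choice of maximizer turns the expectation of a finite maximum into the pairing with
a single simple test vector. -/
theorem exists_measurable_argmax {q : ℕ → Ω → ℝ} (hq : ∀ n, Measurable (q n)) (N : ℕ) :
    ∃ ι : Ω → ℕ, Measurable ι ∧ (∀ ω, ι ω ≤ N) ∧ ∀ ω, partialSups q N ω = q (ι ω) ω := by
  classical
  induction N with
  | zero => exact ⟨fun _ => 0, measurable_const, fun _ => le_rfl, fun ω => by simp⟩
  | succ N ih =>
    obtain ⟨ι, hι, hle, hmax⟩ := ih
    have hm : ∀ n, Measurable (partialSups q n) := fun n => by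
      induction n with
      | zero => simpa using hq 0
      | succ n ih => rw [partialSups_add_one]; exact ih.sup (hq _)
    have hs : MeasurableSet {ω | partialSups q N ω ≤ q (N + 1) ω} := measurableSet_le (hm N) (hq _)
    refine ⟨fun ω => if partialSups q N ω ≤ q (N + 1) ω then N + 1 else ι ω,
      Measurable.ite hs measurable_const hι, fun ω => ?_, fun ω => ?_⟩
    · dsimp only
      split_ifs
      · exact le_rfl
      · exact (hle ω).trans N.le_succ
    · rw [partialSups_add_one, Pi.sup_apply]
      dsimp only
      split_ifs with h
      · exact max_eq_right h
      · rw [← hmax ω]; exact max_eq_left (not_le.1 h).le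

/-- Fenchel's inequality for `θ`. -/
theorem sum_mul_abs_le {ℓ : (Fin d → ℝ) → EReal} {x y : Fin d → ℝ} {g h : ℝ}
    (hx : theta ℓ x ≤ (h : EReal)) (hy : conj (theta ℓ) y ≤ (g : EReal)) :
    ∑ k, |x k| * y k ≤ g + h := by
  have h1 : ((∑ k, |x| k * y k : ℝ) : EReal) - theta ℓ |x| ≤ conj (theta ℓ) y :=
    le_iSup (fun x : Fin d → ℝ => ((∑ k, x k * y k : ℝ) : EReal) - theta ℓ x) |x|
  have h2 : theta ℓ |x| = theta ℓ x := by simp [theta]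
  rw [h2] at h1
  have h3 := (EReal.sub_le_sub (le_refl ((∑ k, |x| k * y k : ℝ) : EReal)) hx).trans (h1.trans hy)
  have h4 : ∑ k, |x| k * y k - h ≤ g := by exact_mod_cast h3
  simpa [sub_le_iff_le_add] using h4

/-- Fenchel's inequality for X and aZ bounds a ∑ Z_k |X_k| by an integrable variable; as Z ≥ 0, each
summand is bounded too. -/
theorem integrable_mul_of_inHeart {ℓ : (Fin d → ℝ) → EReal} {P : Measure Ω}
    {X Z : Ω → Fin d → ℝ} (hX : InHeart ℓ P X)
    (hZ : AEStronglyMeasurable Z P) (hZ0 : ∀ᵐ ω ∂P, 0 ≤ Z ω) {a r : ℝ} (ha : 0 < a)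
    (hE : ExpLE P (fun ω => conj (theta ℓ) (a • Z ω)) r) (k : Fin d) :
    Integrable (fun ω => Z ω k * X ω k) P := by
  obtain ⟨g, hg, hgle, -⟩ := hE
  obtain ⟨s, h, hh, hhle, -⟩ := hX.2 1 zero_le_one
  have hZk : AEStronglyMeasurable (fun ω => Z ω k) P :=
    (continuous_apply k).comp_aestronglyMeasurable hZ
  refine ((hg.add hh).const_mul a⁻¹).mono'
    (hZk.mul (measurable_pi_iff.1 hX.1 k).aestronglyMeasurable) ?_
  filter_upwards [hgle, hhle, hZ0] with ω h1 h2 h0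
  have h3 := sum_mul_abs_le h2 h1
  have h4 : |X ω k| * (a * Z ω k) ≤ ∑ k, |((1 : ℝ) • X ω) k| * (a • Z ω) k := by
    simpa using Finset.single_le_sum (f := fun k => |X ω k| * (a * Z ω k))
      (fun j _ => mul_nonneg (abs_nonneg _) (mul_nonneg ha.le (h0 j))) (Finset.mem_univ k)
  rw [norm_mul, Real.norm_eq_abs, Real.norm_eq_abs, abs_of_nonneg (h0 k), Pi.add_apply,
    inv_mul_eq_div, le_div_iff₀ ha]
  linarith

/-- Where `0 ≤ y`, the conjugate of `θ` is at most the conjugate of `ℓ`. -/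
theorem conj_theta_le {ℓ : (Fin d → ℝ) → EReal} {y : Fin d → ℝ} (hy : 0 ≤ y) :
    conj (theta ℓ) y ≤ conj ℓ y := by
  refine iSup_le fun x => le_trans (EReal.sub_le_sub ?_ le_rfl)
    (le_iSup (fun x : Fin d → ℝ => ((∑ k, x k * y k : ℝ) : EReal) - ℓ x) |x|)
  exact_mod_cast Finset.sum_le_sum fun k _ =>
    mul_le_mul_of_nonneg_right (le_abs_self (x k)) (hy k)

theorem ExpLE.of_const_mul {P : Measure Ω} {f : Ω → EReal} {l r : ℝ} (hl : 0 < l)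
    (h : ExpLE P (fun ω => (l : EReal) * f ω) r) : ExpLE P f (l⁻¹ * r) := by
  obtain ⟨u, hu, hle, hr⟩ := h
  refine ⟨fun ω => l⁻¹ * u ω, hu.const_mul _, ?_, ?_⟩
  · filter_upwards [hle] with ω hω
    have hl' : (0 : EReal) < l := by exact_mod_cast hl
    rw [mul_comm, ← EReal.le_div_iff_mul_le hl' (EReal.coe_ne_top l)] at hω
    refine hω.trans (le_of_eq ?_)
    rw [← EReal.coe_div, div_eq_inv_mul]
  · rw [integral_const_mul]
    gcongr

/-! ### From a supporting functional to a measure density -/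

namespace IsSupporting

variable {ℓ : (Fin d → ℝ) → EReal} {P : Measure Ω} {X : Ω → Fin d → ℝ}
  {ξ : dominated X →ₗ[ℝ] ℝ} {l γ : ℝ}

/-- A supporting functional with positive multiplier yields a measure density whose penalty is
controlled, and which represents the functional in the coordinates where `ℓ` is finite. -/
theorem exists_dual_density [IsProbabilityMeasure P] (h : IsSupporting ℓ P X ξ l γ)
    (hℓ : IsLossFunction ℓ) (hl : 0 < l) :
    ∃ Z : Ω → Fin d → ℝ, Measurable Z ∧ (∀ ω, 0 ≤ Z ω) ∧
      (∀ k, Integrable (fun ω => Z ω k) P ∧ ∫ ω, Z ω k ∂P = 1) ∧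
      ExpLE P (fun ω => (l : EReal) * conj ℓ (l⁻¹ • Z ω)) γ ∧
      ∀ k, (∀ n : ℕ, ℓ (Pi.single k (n : ℝ)) < ⊤) → ∀ A (hA : MeasurableSet A),
        ξ (onSet X hA (Pi.single k 1)) = ∫ ω in A, Z ω k ∂P := by
  obtain ⟨Z, hZm, hZ0, hZi, hZ1, hrep, hclaim⟩ := h.exists_density hℓ
  obtain ⟨x, r, hxr, hconj⟩ := exists_seq_conj_le hℓ
  -- The mass lost with the singular remainder, to be put back as a constant.
  set s : Fin d → ℝ := fun k => 1 - ∫ ω, Z ω k ∂P with hs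
  have hs0 : ∀ k, 0 ≤ s k := fun k => sub_nonneg.2 (hZ1 k)
  have hZsi : ∀ k, Integrable (fun ω => Z ω k + s k) P := fun k =>
    (hZi k).add (integrable_const _)
  have hZm' : ∀ k, Measurable fun ω => Z ω k := measurable_pi_iff.1 hZm
  refine ⟨fun ω k => Z ω k + s k, measurable_pi_iff.2 fun k => (hZm' k).add_const _,
    fun ω k => add_nonneg (hZ0 ω k) (hs0 k), fun k => ⟨hZsi k, ?_⟩, ?_, ?_⟩
  · rw [integral_add (hZi k) (integrable_const _)]
    simp [hs]
  · let q : ℕ → Ω → ℝ := fun i ω => ∑ k, x i k * (Z ω k + s k) - l * r i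
    have hqi : ∀ i, Integrable (q i) P := fun i =>
      (integrable_finsetSum _ fun k _ => (hZsi k).const_mul _).sub (integrable_const _)
    have hqm : ∀ i, Measurable (q i) := fun i =>
      (Finset.measurable_sum _ fun k _ => ((hZm' k).add_const _).const_mul _).sub_const _
    refine (expLE_iSup hqi (r := γ) fun N => ?_).mono
      (Eventually.of_forall fun ω => hconj l _ hl) le_rfl
    obtain ⟨ι, hι, hιN, hmax⟩ := exists_measurable_argmax hqm N
    -- Since max (u + v) ≤ max u + max v, the term paired with `s` is maximized separately. Its
    -- maximizer x_j is the value used on the sets that carry the remainder.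
    obtain ⟨j, -, hj⟩ := Finset.exists_max_image (Finset.range (N + 1))
      (fun i => ∑ k, x i k * s k) ⟨0, by simp⟩
    obtain ⟨hint, hle⟩ := hclaim x r hxr (x j) (r j) (hxr j) ι N hι hιN
    have hpt : ∀ ω, partialSups q N ω ≤
        (∑ k, x (ι ω) k * Z ω k - l * r (ι ω)) + ∑ k, x j k * s k := fun ω => by
      rw [hmax ω]
      have := hj (ι ω) (Finset.mem_range.2 (Nat.lt_succ_of_le (hιN ω)))
      simp only [q, mul_add, Finset.sum_add_distrib]
      linarith
    refine (integral_mono (integrable_partialSups hqi N)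
      (hint.add (integrable_const _)) hpt).trans ?_
    have := integral_add hint (integrable_const (∑ k, x j k * s k))
    simp only [integral_const, probReal_univ, smul_eq_mul, one_mul] at this
    simp only [Pi.add_apply]
    rw [this]
    exact hle
  · intro k hk A hA
    -- Every n e_k has finite loss and may be used as x₀, so n s_k stays bounded in n.
    have hsk : s k = 0 := by
      refine le_antisymm ?_ (hs0 k)
      by_contra hpos
      push Not at hpos
      choose c hc using fun n : ℕ => hℓ.exists_real (hk n)
      set I := ∫ ω, (∑ k, x 0 k * Z ω k - l * r 0) ∂P
      have hle : ∀ n : ℕ, I + n * s k ≤ γ := fun n => by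
        have := (hclaim x r hxr (Pi.single k (n : ℝ)) (c n) (hc n).le (fun _ => 0) 0
          measurable_const (fun _ => le_rfl)).2
        simpa [Pi.single_apply, I, hs] using this
      obtain ⟨n, hn⟩ := exists_nat_gt ((γ - I) / s k)
      rw [div_lt_iff₀ hpos] at hn
      linarith [hle n]
    rw [hrep k (by simp only [hs] at hsk; linarith) A hA]
    simp [hsk]

end IsSupporting

/-! ### Representation of the functional at X -/

/-- The coordinate `k` of a vector, and `0` in the other coordinates. -/
def onCoord (X : Ω → Fin d → ℝ) (k : Fin d) {W : Ω → ℝ} (hW : Measurable W) {a : ℝ}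
    (ha : 0 ≤ a) (hle : ∀ ω, |W ω| ≤ a * |X ω k|) : dominated X :=
  ⟨fun ω => Pi.single k (W ω), measurable_pi_iff.2 fun j => by
      by_cases hj : j = k
      · subst hj; simpa using hW
      · simp [Pi.single_eq_of_ne hj],
    a, 0, ha, fun ω j => by
      by_cases hj : j = k
      · subst hj; simpa using hle ω
      · simp [Pi.single_eq_of_ne hj]; positivity⟩

namespace IsSupporting

variable {ℓ : (Fin d → ℝ) → EReal} {P : Measure Ω} {X : Ω → Fin d → ℝ}
  {ξ : dominated X →ₗ[ℝ] ℝ} {l γ : ℝ}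

/-- A supporting functional is continuous along dominated sequences in a coordinate. -/
theorem tendsto_map_onCoord [IsProbabilityMeasure P] (h : IsSupporting ℓ P X ξ l γ)
    (hℓ : IsLossFunction ℓ) (hX : InHeart ℓ P X) {k : Fin d} (hk : ℓ (Pi.single k 1) < ⊤)
    {V : ℕ → Ω → ℝ} (hV : ∀ n, Measurable (V n)) {a : ℝ} (ha : 0 ≤ a)
    (hle : ∀ n ω, |V n ω| ≤ a * |X ω k|) (hlim : ∀ ω, Tendsto (fun n => V n ω) atTop (𝓝 0)) :
    Tendsto (fun n => ξ (onCoord X k (hV n) ha (hle n))) atTop (𝓝 0) := by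
  obtain ⟨c, hc⟩ := hℓ.exists_real hk
  set C := γ + l * (c + 1) with hC
  have hcc : ℓ (Pi.single k 1) < ((c + 1 : ℝ) : EReal) := by
    rw [hc]; exact_mod_cast lt_add_one c
  -- For fixed t the vectors t V_n e_k are eventually below e_k at each point, with majorant θ(|t| a
  -- X), so their expected loss is eventually at most c + 1. The bound `C` does not depend on t, and
  -- large t of both signs force the limit 0.
  have key : ∀ t : ℝ, ∀ᶠ n in atTop, t * ξ (onCoord X k (hV n) ha (hle n)) ≤ C := by
    intro t
    obtain ⟨_, T, hT, hTle, -⟩ := hX.2 (|t| * a) (by positivity)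
    have hev := eventually_expLE hℓ (P := P)
      (Y := fun n => ((t • onCoord X k (hV n) ha (hle n) : dominated X) : Ω → Fin d → ℝ))
      (fun n => (t • onCoord X k (hV n) ha (hle n)).2.1) hT hcc ?_ ?_
    · filter_upwards [hev] with n hn
      have := h.le _ _ hn
      rw [map_smul, smul_eq_mul] at this
      linarith
    · refine Eventually.of_forall fun n => ?_
      filter_upwards [hTle] with ω hω
      refine le_trans (le_theta hℓ fun j => ?_) hω
      have hval : ((t • onCoord X k (hV n) ha (hle n) : dominated X) : Ω → Fin d → ℝ) ω j =
          t * (Pi.single k (V n ω) : Fin d → ℝ) j := rfl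
      rw [hval]
      by_cases hj : j = k
      · subst hj
        rw [Pi.single_eq_same, Pi.smul_apply, smul_eq_mul, abs_mul,
          abs_of_nonneg (by positivity : 0 ≤ |t| * a), mul_assoc]
        refine (le_abs_self _).trans ?_
        rw [abs_mul]
        exact mul_le_mul_of_nonneg_left (hle n ω) (abs_nonneg t)
      · rw [Pi.single_eq_of_ne hj, mul_zero]
        exact abs_nonneg _
    · intro ω
      have h1 : Tendsto (fun n => t * V n ω) atTop (𝓝 0) := by
        simpa using (hlim ω).const_mul t
      filter_upwards [h1.eventually_le_const zero_lt_one] with n hn j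
      change t * (Pi.single k (V n ω) : Fin d → ℝ) j ≤ (Pi.single k 1 : Fin d → ℝ) j
      by_cases hj : j = k
      · subst hj; simpa using hn
      · simp [Pi.single_eq_of_ne hj]
  rw [Metric.tendsto_nhds]
  intro ε hε
  set t := (|C| + 1) / ε
  have ht : 0 < t := by positivity
  have htε : t * ε = |C| + 1 := by simp only [t]; field_simp
  filter_upwards [key t, key (-t)] with n h1 h2
  rw [Real.dist_eq, sub_zero, abs_lt]
  have hCa := le_abs_self C
  constructor <;> nlinarith

theorem map_onCoord_simpleFunc [IsProbabilityMeasure P] {Z : Ω → Fin d → ℝ} {k : Fin d}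
    (hZ : Integrable (fun ω => Z ω k) P)
    (hrep : ∀ A (hA : MeasurableSet A), ξ (onSet X hA (Pi.single k 1)) = ∫ ω in A, Z ω k ∂P)
    (S : SimpleFunc Ω ℝ) {a : ℝ} (ha : 0 ≤ a) (hle : ∀ ω, |S ω| ≤ a * |X ω k|) :
    ξ (onCoord X k S.measurable ha hle) = ∫ ω, Z ω k * S ω ∂P := by
  have hpt : ∀ ω, S ω = ∑ y ∈ S.range, (S ⁻¹' {y}).indicator (fun _ => y) ω := fun ω => by
    rw [Finset.sum_eq_single (S ω)]
    · simp
    · intro y _ hy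
      exact Set.indicator_of_notMem (fun hmem => hy (by simpa using hmem.symm)) _
    · intro hnot
      exact absurd (S.mem_range_self ω) hnot
  have h1 : onCoord X k S.measurable ha hle =
      ∑ y ∈ S.range, y • onSet X (S.measurableSet_fiber y) (Pi.single k 1) := by
    ext ω j
    simp only [Submodule.coe_sum, Submodule.coe_smul, Finset.sum_apply, Pi.smul_apply,
      smul_eq_mul, onSet_apply]
    change (Pi.single k (S ω) : Fin d → ℝ) j = _
    by_cases hj : j = k
    · subst hj
      rw [Pi.single_eq_same]
      conv_lhs => rw [hpt ω]
      refine Finset.sum_congr rfl fun y _ => ?_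
      simp only [Set.indicator]
      split_ifs <;> simp
    · rw [Pi.single_eq_of_ne hj, Finset.sum_eq_zero]
      intro y _
      simp only [Set.indicator]
      split_ifs <;> simp [Pi.single_eq_of_ne hj]
  have h2 : ∀ ω, Z ω k * S ω = ∑ y ∈ S.range, (S ⁻¹' {y}).indicator (fun ω => y * Z ω k) ω := by
    intro ω
    conv_lhs => rw [hpt ω, Finset.mul_sum]
    refine Finset.sum_congr rfl fun y _ => ?_
    simp only [Set.indicator]
    split_ifs <;> ring
  rw [h1, map_sum]
  simp only [h2]
  rw [integral_finsetSum _ fun y _ => (hZ.const_mul y).indicator (S.measurableSet_fiber y)]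
  refine Finset.sum_congr rfl fun y _ => ?_
  rw [map_smul, hrep, integral_indicator (S.measurableSet_fiber y), integral_const_mul,
    smul_eq_mul]

/-- Simple functions S_n → X_k with |S_n| ≤ 2|X_k| reduce the claim to indicators. On the errors,
which are at most 3|X_k|, ξ tends to 0 by continuity along dominated sequences. -/
theorem map_onCoord_self [IsProbabilityMeasure P] (h : IsSupporting ℓ P X ξ l γ)
    (hℓ : IsLossFunction ℓ) (hX : InHeart ℓ P X) {Z : Ω → Fin d → ℝ} {k : Fin d}
    (hk : ℓ (Pi.single k 1) < ⊤) (hZ : Integrable (fun ω => Z ω k) P)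
    (hZX : Integrable (fun ω => Z ω k * X ω k) P)
    (hrep : ∀ A (hA : MeasurableSet A), ξ (onSet X hA (Pi.single k 1)) = ∫ ω in A, Z ω k ∂P) :
    ξ (onCoord X k (measurable_pi_iff.1 hX.1 k) zero_le_one fun _ => (one_mul _).ge) =
      ∫ ω, Z ω k * X ω k ∂P := by
  have hXk := measurable_pi_iff.1 hX.1 k
  let S : ℕ → SimpleFunc Ω ℝ := fun n =>
    SimpleFunc.approxOn _ hXk Set.univ 0 (Set.mem_univ _) n
  have hSlim : ∀ ω, Tendsto (fun n => S n ω) atTop (𝓝 (X ω k)) := fun ω =>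
    SimpleFunc.tendsto_approxOn hXk (Set.mem_univ _) (by simp)
  have hSle : ∀ n ω, |S n ω| ≤ 2 * |X ω k| := fun n ω => by
    have := SimpleFunc.norm_approxOn_zero_le hXk (Set.mem_univ (0 : ℝ)) ω n
    rw [Real.norm_eq_abs, Real.norm_eq_abs] at this
    simp only [S]
    linarith
  have hVm : ∀ n, Measurable fun ω => X ω k - S n ω := fun n => hXk.sub (S n).measurable
  have hVle : ∀ n ω, |X ω k - S n ω| ≤ 3 * |X ω k| := fun n ω => by
    have h1 := abs_sub (X ω k) (S n ω)
    have h2 := hSle n ω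
    linarith
  have hVlim := h.tendsto_map_onCoord hℓ hX hk hVm (by norm_num) hVle fun ω => by
    simpa using (hSlim ω).const_sub (X ω k)
  have hint : Tendsto (fun n => ∫ ω, Z ω k * S n ω ∂P) atTop (𝓝 (∫ ω, Z ω k * X ω k ∂P)) := by
    refine tendsto_integral_of_dominated_convergence (fun ω => 2 * |Z ω k * X ω k|)
      (fun n => hZ.aestronglyMeasurable.mul (S n).measurable.aestronglyMeasurable)
      (hZX.abs.const_mul 2) (fun n => Eventually.of_forall fun ω => ?_)
      (Eventually.of_forall fun ω => (hSlim ω).const_mul _)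
    rw [Real.norm_eq_abs, abs_mul, abs_mul]
    have := mul_le_mul_of_nonneg_left (hSle n ω) (abs_nonneg (Z ω k))
    linarith
  have hsum : ∀ n, ξ (onCoord X k hXk zero_le_one fun _ => (one_mul _).ge) =
      ξ (onCoord X k (hVm n) (by norm_num) (hVle n)) + ∫ ω, Z ω k * S n ω ∂P := fun n => by
    rw [← map_onCoord_simpleFunc hZ hrep (S n) (by norm_num) (hSle n), ← map_add]
    congr 1
    ext ω j
    change (Pi.single k (X ω k) : Fin d → ℝ) j =
      (Pi.single k (X ω k - S n ω) : Fin d → ℝ) j + (Pi.single k (S n ω) : Fin d → ℝ) j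
    by_cases hj : j = k
    · subst hj; simp
    · simp [Pi.single_eq_of_ne hj]
  have := hVlim.add hint
  simp only [← hsum, zero_add] at this
  exact tendsto_nhds_unique tendsto_const_nhds this

end IsSupporting

/-- At some ω with X_k(ω) ≠ 0 all the θ(N X(ω)) are finite, and N|X(ω)| dominates n e_k for large N.
-/
theorem InHeart.loss_single_lt_top {ℓ : (Fin d → ℝ) → EReal} (hℓ : IsLossFunction ℓ)
    {P : Measure Ω} {X : Ω → Fin d → ℝ} (hX : InHeart ℓ P X) {k : Fin d}
    (hk : ¬ ∀ᵐ ω ∂P, X ω k = 0) (n : ℕ) : ℓ (Pi.single k (n : ℝ)) < ⊤ := by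
  have hfin : ∀ᵐ ω ∂P, ∀ N : ℕ, theta ℓ ((N : ℝ) • X ω) < ⊤ := ae_all_iff.2 fun N => by
    obtain ⟨_, h, -, hle, -⟩ := hX.2 N N.cast_nonneg
    exact hle.mono fun ω hω => hω.trans_lt (EReal.coe_lt_top _)
  obtain ⟨ω, hω, hω2⟩ := ((not_eventually.1 hk).and_eventually hfin).exists
  have hpos : 0 < |X ω k| := abs_pos.2 hω
  obtain ⟨N, hN⟩ := exists_nat_ge (n / |X ω k|)
  rw [div_le_iff₀ hpos] at hN
  refine lt_of_le_of_lt (le_theta hℓ fun j => ?_) (hω2 N)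
  by_cases hj : j = k
  · subst hj
    simpa [abs_mul] using hN
  · rw [Pi.single_eq_of_ne hj]
    exact abs_nonneg _

/-- Existence of an optimal measure density in the dual representation. -/
theorem exists_optimal_density {ℓ : (Fin d → ℝ) → EReal} (hℓ : IsLossFunction ℓ)
    {P : Measure Ω} [IsProbabilityMeasure P] {X : Ω → Fin d → ℝ} (hX : InHeart ℓ P X) {ρ : ℝ}
    (hρ : ∀ m : Fin d → ℝ, ExpLE P (fun ω => ℓ (X ω - m)) 0 → ρ ≤ ∑ k, m k) :
    ∃ Z : Ω → Fin d → ℝ, Measurable Z ∧ (∀ ω, 0 ≤ Z ω) ∧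
      (∀ k, Integrable (fun ω => Z ω k) P ∧ ∫ ω, Z ω k ∂P = 1) ∧
      ∀ ε : ℝ, 0 < ε → ∃ l : ℝ, 0 < l ∧ ExpLE P (fun ω => (l : EReal) * conj ℓ (l⁻¹ • Z ω))
        (∫ ω, ∑ k, Z ω k * X ω k ∂P - ρ + ε) := by
  obtain ⟨ξ, l, hl, hconst, hle⟩ := exists_supporting_functional hℓ hX hρ
  set γ := ξ ⟨X, self_mem_dominated hX.1⟩ - ρ with hγ
  have h : IsSupporting ℓ P X ξ l γ := ⟨hl, hconst, hle⟩
  rcases hl.eq_or_lt with rfl | hl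
  -- With multiplier 0, the coordinate sum is at most `γ` on the domain of ℓ. This rules out finite
  -- loss at all n e_k, so X vanishes almost surely.
  · have hsum : ∀ (x : Fin d → ℝ) (r : ℝ), ℓ x = (r : EReal) → ∑ k, x k ≤ γ := fun x r hr => by
      have := h.le ⟨fun _ => x, const_mem_dominated X x⟩ r
        (expLE_const (Eventually.of_forall fun _ => hr.le))
      rwa [hconst, zero_mul, sub_zero] at this
    have hX0 : ∀ᵐ ω ∂P, X ω = 0 := by
      have : ∀ k, ∀ᵐ ω ∂P, X ω k = 0 := fun k => by
        by_contra hk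
        obtain ⟨n, hn⟩ := exists_nat_gt γ
        obtain ⟨r, hr⟩ := hℓ.exists_real (hX.loss_single_lt_top hℓ hk n)
        have := hsum _ _ hr
        rw [Finset.sum_pi_single' k (n : ℝ) Finset.univ] at this
        simp only [Finset.mem_univ, if_true] at this
        linarith
      filter_upwards [ae_all_iff.2 this] with ω hω using funext hω
    have hγ' : γ = -ρ := by
      rw [hγ, h.map_eq_zero hℓ hX0, zero_sub]
    have hint : ∫ ω, ∑ k, (1 : ℝ) * X ω k ∂P = 0 := by
      rw [integral_eq_zero_of_ae]
      filter_upwards [hX0] with ω hω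
      simp [hω]
    obtain ⟨c, hc⟩ := hℓ.lower_bound
    refine ⟨fun _ _ => 1, measurable_const, fun _ _ => zero_le_one,
      fun k => ⟨integrable_const _, by simp⟩, fun ε hε => ?_⟩
    -- The multiplier must be positive, hence the ε. From r ≥ ∑ x_k - c and ∑ x_k ≤ γ one gets ∑ x_k
    -- - s r ≤ (1 - s) γ + s c = γ + s (c - γ), and this `s` makes the excess at most ε.
    set s := min 1 (ε / (|c - γ| + 1)) with hs
    have hs0 : 0 < s := lt_min one_pos (by positivity)
    have hs1 : s ≤ 1 := min_le_left _ _
    have hs2 : s * (c - γ) ≤ ε := by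
      have h1 : s * (|c - γ| + 1) ≤ ε := by
        have := min_le_right 1 (ε / (|c - γ| + 1))
        rwa [← hs, le_div_iff₀ (by positivity)] at this
      have h2 := mul_le_mul_of_nonneg_left (le_abs_self (c - γ)) hs0.le
      linarith
    refine ⟨s, hs0, expLE_const (Eventually.of_forall fun ω => ?_)⟩
    refine mul_conj_le hs0 hℓ.ne_bot fun x r hxr => ?_
    have h1 := hsum x r hxr
    have h2 : ∑ k, x k - c ≤ r := by
      have := hc x
      rw [hxr] at this
      exact_mod_cast this
    rw [hint]
    simp only [mul_one]
    have h3 := mul_le_mul_of_nonneg_left h2 hs0.le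
    have h4 := mul_le_mul_of_nonneg_left h1 (sub_nonneg.2 hs1)
    exact_mod_cast (by linarith : ∑ k, x k - s * r ≤ 0 - ρ + ε)
  · obtain ⟨Z, hZm, hZ0, hZi, hE, hrep⟩ := h.exists_dual_density hℓ hl
    refine ⟨Z, hZm, hZ0, hZi, fun ε hε =>
      ⟨l, hl, hE.mono (Eventually.of_forall fun _ => le_rfl) ?_⟩⟩
    have hEθ : ExpLE P (fun ω => conj (theta ℓ) (l⁻¹ • Z ω)) (l⁻¹ * γ) :=
      (hE.of_const_mul hl).mono (Eventually.of_forall fun ω =>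
        conj_theta_le (smul_nonneg (inv_nonneg.2 hl.le) (hZ0 ω))) le_rfl
    have hZX := integrable_mul_of_inHeart hX hZm.aestronglyMeasurable
      (Eventually.of_forall hZ0) (inv_pos.2 hl) hEθ
    have hcoord : ∀ k, ξ (onCoord X k (measurable_pi_iff.1 hX.1 k) zero_le_one
        fun _ => (one_mul _).ge) = ∫ ω, Z ω k * X ω k ∂P := fun k => by
      by_cases hk : ∀ᵐ ω ∂P, X ω k = 0
      · rw [h.map_eq_zero hℓ, integral_eq_zero_of_ae]
        · filter_upwards [hk] with ω hω
          simp [hω]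
        · filter_upwards [hk] with ω hω
          change (Pi.single k (X ω k) : Fin d → ℝ) = 0
          rw [hω, Pi.single_zero]
      · have hfin := hX.loss_single_lt_top hℓ hk
        exact h.map_onCoord_self hℓ hX (by simpa using hfin 1) (hZi k).1 (hZX k) (hrep k hfin)
    have hself : (⟨X, self_mem_dominated hX.1⟩ : dominated X) =
        ∑ k, onCoord X k (measurable_pi_iff.1 hX.1 k) zero_le_one fun _ => (one_mul _).ge := by
      ext ω j
      rw [Submodule.coe_sum, Finset.sum_apply, Finset.sum_apply]
      change X ω j = ∑ k, (Pi.single k (X ω k) : Fin d → ℝ) j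
      simp [Pi.single_apply]
    have : ξ ⟨X, self_mem_dominated hX.1⟩ = ∫ ω, ∑ k, Z ω k * X ω k ∂P := by
      rw [hself, map_sum, integral_finsetSum _ fun k _ => hZX k]
      exact Finset.sum_congr rfl fun k _ => hcoord k
    rw [← this]
    linarith

/-! ### The Orlicz heart as a vector space -/

theorem InHeart.congr {ℓ : (Fin d → ℝ) → EReal} {P : Measure Ω} {X Y : Ω → Fin d → ℝ}
    (hX : InHeart ℓ P X) (hY : Measurable Y) (h : ∀ᵐ ω ∂P, Y ω = X ω) : InHeart ℓ P Y :=
  ⟨hY, fun a ha => by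
    obtain ⟨r, hr⟩ := hX.2 a ha
    exact ⟨r, hr.mono (h.mono fun ω hω => by rw [hω]) le_rfl⟩⟩

theorem InHeart.const_smul {ℓ : (Fin d → ℝ) → EReal} {P : Measure Ω}
    {X : Ω → Fin d → ℝ} (hX : InHeart ℓ P X) (c : ℝ) : InHeart ℓ P (fun ω => c • X ω) :=
  ⟨hX.1.const_smul c, fun a _ => by
    obtain ⟨r, hr⟩ := hX.2 |a * c| (abs_nonneg _)
    refine ⟨r, hr.mono (Eventually.of_forall fun ω => le_of_eq ?_) le_rfl⟩
    simp only [theta]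
    congr 1
    ext k
    simp [abs_mul, mul_assoc]⟩

theorem InHeart.add {ℓ : (Fin d → ℝ) → EReal} (hℓ : IsLossFunction ℓ) {P : Measure Ω}
    {X Y : Ω → Fin d → ℝ} (hX : InHeart ℓ P X) (hY : InHeart ℓ P Y) :
    InHeart ℓ P (fun ω => X ω + Y ω) :=
  ⟨hX.1.add hY.1, fun a ha => by
    obtain ⟨r, hr⟩ := hX.2 (2 * a) (by positivity)
    obtain ⟨s, hs⟩ := hY.2 (2 * a) (by positivity)
    refine ⟨_, (hr.convexComb hℓ one_half_pos one_half_pos (by norm_num) hs).mono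
      (Eventually.of_forall fun ω => hℓ.mono fun k => ?_) le_rfl⟩
    simp only [Pi.abs_apply, Pi.smul_apply, Pi.add_apply, smul_eq_mul, abs_mul, abs_two]
    have := mul_le_mul_of_nonneg_left (abs_add_le (X ω k) (Y ω k)) (abs_nonneg a)
    linarith⟩

theorem mem_orliczHeart_iff {ℓ : (Fin d → ℝ) → EReal} (hℓ : IsLossFunction ℓ)
    {P : Measure Ω} [IsProbabilityMeasure P] {X : Ω →ₘ[P] (Fin d → ℝ)} :
    X ∈ orliczHeart (theta ℓ) P ↔ InHeart ℓ P X := by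
  obtain ⟨c, hc⟩ := hℓ.lower_bound
  have hm : Measurable (X : Ω → Fin d → ℝ) := X.stronglyMeasurable.measurable
  refine ⟨fun h => ⟨hm, fun a ha => exists_expLE_of_eexp_lt_top (g := fun _ => -c)
    ((measurable_theta hℓ).comp (hm.const_smul a)).aemeasurable (integrable_const _)
    (Eventually.of_forall fun ω => ?_) (h a ha)⟩, fun h a ha => ?_⟩
  · refine le_trans ?_ (hc _)
    have : 0 ≤ ∑ k, |a • X ω| k := Finset.sum_nonneg fun k _ => abs_nonneg _
    exact_mod_cast (by linarith : -c ≤ ∑ k, |a • X ω| k - c)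
  · obtain ⟨r, hr⟩ := h.2 a ha
    exact hr.eexp_le.trans_lt (EReal.coe_lt_top r)

theorem smul_mem_orliczHeart {ℓ : (Fin d → ℝ) → EReal} (hℓ : IsLossFunction ℓ)
    {P : Measure Ω} [IsProbabilityMeasure P] {X : Ω →ₘ[P] (Fin d → ℝ)}
    (hX : X ∈ orliczHeart (theta ℓ) P) (c : ℝ) : c • X ∈ orliczHeart (theta ℓ) P := by
  rw [mem_orliczHeart_iff hℓ] at hX ⊢
  exact (hX.const_smul c).congr (AEEqFun.stronglyMeasurable _).measurable
    (AEEqFun.coeFn_smul c X)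

theorem add_mem_orliczHeart {ℓ : (Fin d → ℝ) → EReal} (hℓ : IsLossFunction ℓ)
    {P : Measure Ω} [IsProbabilityMeasure P] {X Y : Ω →ₘ[P] (Fin d → ℝ)}
    (hX : X ∈ orliczHeart (theta ℓ) P) (hY : Y ∈ orliczHeart (theta ℓ) P) :
    X + Y ∈ orliczHeart (theta ℓ) P := by
  rw [mem_orliczHeart_iff hℓ] at hX hY ⊢
  exact (hX.add hℓ hY).congr (AEEqFun.stronglyMeasurable _).measurable
    (AEEqFun.coeFn_add X Y)

theorem sub_mem_orliczHeart {ℓ : (Fin d → ℝ) → EReal} (hℓ : IsLossFunction ℓ)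
    {P : Measure Ω} [IsProbabilityMeasure P] {X Y : Ω →ₘ[P] (Fin d → ℝ)}
    (hX : X ∈ orliczHeart (theta ℓ) P) (hY : Y ∈ orliczHeart (theta ℓ) P) :
    X - Y ∈ orliczHeart (theta ℓ) P := by
  rw [sub_eq_add_neg, ← neg_one_smul ℝ Y]
  exact add_mem_orliczHeart hℓ hX (smul_mem_orliczHeart hℓ hY _)

/-! ### Elementary properties of the risk -/

theorem risk_eq_coe {ℓ : (Fin d → ℝ) → EReal} {P : Measure Ω} {X : Ω →ₘ[P] (Fin d → ℝ)} {ρ : ℝ}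
    (hle : ∀ m ∈ acceptable ℓ P X, ρ ≤ ∑ k, m k)
    (hlt : ∀ ε > 0, ∃ m ∈ acceptable ℓ P X, ∑ k, m k < ρ + ε) : risk ℓ P X = (ρ : EReal) := by
  refine le_antisymm ?_ (le_iInf₂ fun m hm => by exact_mod_cast hle m hm)
  refine EReal.le_of_forall_lt_iff_le.1 fun q hq => ?_
  have hq' : ρ < q := by exact_mod_cast hq
  obtain ⟨m, hm, hmq⟩ := hlt (q - ρ) (sub_pos.2 hq')
  refine (iInf₂_le m hm).trans ?_
  exact_mod_cast (by linarith : ∑ k, m k ≤ q)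

theorem mem_acceptable_iff {ℓ : (Fin d → ℝ) → EReal} (hℓ : IsLossFunction ℓ) {P : Measure Ω}
    [IsProbabilityMeasure P] {X : Ω →ₘ[P] (Fin d → ℝ)} (hX : X ∈ orliczHeart (theta ℓ) P)
    {m : Fin d → ℝ} : m ∈ acceptable ℓ P X ↔ ExpLE P (fun ω => ℓ (X ω - m)) 0 := by
  rw [mem_orliczHeart_iff hℓ] at hX
  have := expLE_loss_iff hℓ (P := P) (Y := fun ω => X ω - m) (hX.1.sub_const m).aemeasurable
    (fun k => (hX.integrable hℓ k).sub (integrable_const _)) (r := 0)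
  rw [this]
  rfl

/-- The shortfall risk is real on the Orlicz heart. -/
theorem exists_risk_eq_coe {ℓ : (Fin d → ℝ) → EReal} (hℓ : IsLossFunction ℓ) {P : Measure Ω}
    [IsProbabilityMeasure P] {X : Ω →ₘ[P] (Fin d → ℝ)} (hX : X ∈ orliczHeart (theta ℓ) P) :
    ∃ ρ : ℝ, risk ℓ P X = (ρ : EReal) ∧ (∀ m ∈ acceptable ℓ P X, ρ ≤ ∑ k, m k) ∧
      ∀ ε > 0, ∃ m ∈ acceptable ℓ P X, ∑ k, m k < ρ + ε := by
  have hX' := (mem_orliczHeart_iff hℓ).1 hX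
  obtain ⟨c, hc⟩ := hℓ.lower_bound
  obtain ⟨x, hx⟩ := iInf_lt_iff.1 hℓ.inf_neg
  obtain ⟨n, hn⟩ := exists_expLE_sub_const hℓ hX' (self_mem_dominated hX'.1) (r := 0) hx
  set S : Set ℝ := (fun m : Fin d → ℝ => ∑ k, m k) '' acceptable ℓ P X
  have hne : S.Nonempty := ⟨_, fun _ => n, (mem_acceptable_iff hℓ hX).2 hn, rfl⟩
  have hbdd : BddBelow S := by
    -- Integrating ℓ(X - m) ≥ ∑ X_k - ∑ m_k - c against the constraint bounds ∑ m_k from below.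
    refine ⟨∫ ω, ∑ k, X ω k ∂P - c, ?_⟩
    rintro _ ⟨m, hm, rfl⟩
    have hi : Integrable (fun ω => ∑ k, X ω k) P :=
      integrable_finsetSum _ fun k _ => hX'.integrable hℓ k
    have := ((mem_acceptable_iff hℓ hX).1 hm).integral_le
      (g := fun ω => ∑ k, X ω k - (∑ k, m k + c)) (hi.sub (integrable_const _))
      (Eventually.of_forall fun ω => (le_of_eq ?_).trans (hc (X ω - m)))
    · rw [integral_sub hi (integrable_const _)] at this
      simp only [integral_const, probReal_univ, smul_eq_mul, one_mul] at this
      dsimp only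
      linarith
    · congr 1
      simp only [Pi.sub_apply, Finset.sum_sub_distrib]
      ring
  have h1 : ∀ m ∈ acceptable ℓ P X, sInf S ≤ ∑ k, m k := fun m hm => csInf_le hbdd ⟨m, hm, rfl⟩
  have h2 : ∀ ε > 0, ∃ m ∈ acceptable ℓ P X, ∑ k, m k < sInf S + ε := fun ε hε => by
    obtain ⟨_, ⟨m, hm, rfl⟩, hlt⟩ := exists_lt_of_csInf_lt hne (lt_add_of_pos_right (sInf S) hε)
    exact ⟨m, hm, hlt⟩
  exact ⟨sInf S, risk_eq_coe h1 h2, h1, h2⟩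

theorem coe_toReal_risk {ℓ : (Fin d → ℝ) → EReal} (hℓ : IsLossFunction ℓ) {P : Measure Ω}
    [IsProbabilityMeasure P] {X : Ω →ₘ[P] (Fin d → ℝ)} (hX : X ∈ orliczHeart (theta ℓ) P) :
    (((risk ℓ P X).toReal : ℝ) : EReal) = risk ℓ P X := by
  obtain ⟨ρ, h, -⟩ := exists_risk_eq_coe hℓ hX
  rw [h, EReal.toReal_coe]

theorem toReal_risk_le {ℓ : (Fin d → ℝ) → EReal} (hℓ : IsLossFunction ℓ) {P : Measure Ω}
    [IsProbabilityMeasure P] {X : Ω →ₘ[P] (Fin d → ℝ)} (hX : X ∈ orliczHeart (theta ℓ) P)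
    {m : Fin d → ℝ} (hm : ExpLE P (fun ω => ℓ (X ω - m)) 0) :
    (risk ℓ P X).toReal ≤ ∑ k, m k := by
  obtain ⟨ρ, h, h1, -⟩ := exists_risk_eq_coe hℓ hX
  rw [h, EReal.toReal_coe]
  exact h1 m ((mem_acceptable_iff hℓ hX).2 hm)

theorem exists_lt_toReal_risk_add {ℓ : (Fin d → ℝ) → EReal} (hℓ : IsLossFunction ℓ)
    {P : Measure Ω} [IsProbabilityMeasure P] {X : Ω →ₘ[P] (Fin d → ℝ)}
    (hX : X ∈ orliczHeart (theta ℓ) P) {ε : ℝ} (hε : 0 < ε) :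
    ∃ m : Fin d → ℝ, ExpLE P (fun ω => ℓ (X ω - m)) 0 ∧
      ∑ k, m k < (risk ℓ P X).toReal + ε := by
  obtain ⟨ρ, h, -, h2⟩ := exists_risk_eq_coe hℓ hX
  rw [h, EReal.toReal_coe]
  obtain ⟨m, hm, hlt⟩ := h2 ε hε
  exact ⟨m, (mem_acceptable_iff hℓ hX).1 hm, hlt⟩

theorem convexOn_risk {ℓ : (Fin d → ℝ) → EReal} (hℓ : IsLossFunction ℓ) {P : Measure Ω}
    [IsProbabilityMeasure P] :
    ConvexOn ℝ (orliczHeart (theta ℓ) P) (fun X => (risk ℓ P X).toReal) := by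
  have hmem : ∀ {X Y : Ω →ₘ[P] (Fin d → ℝ)}, X ∈ orliczHeart (theta ℓ) P →
      Y ∈ orliczHeart (theta ℓ) P → ∀ a b : ℝ, a • X + b • Y ∈ orliczHeart (theta ℓ) P :=
    fun hX hY a b => add_mem_orliczHeart hℓ (smul_mem_orliczHeart hℓ hX a)
      (smul_mem_orliczHeart hℓ hY b)
  refine convexOn_iff_forall_pos.2 ⟨fun X hX Y hY a b _ _ _ => hmem hX hY a b,
    fun X hX Y hY a b ha hb hab => ?_⟩
  refine le_of_forall_pos_le_add fun ε hε => ?_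
  obtain ⟨m, hm, hmlt⟩ := exists_lt_toReal_risk_add hℓ hX hε
  obtain ⟨n, hn, hnlt⟩ := exists_lt_toReal_risk_add hℓ hY hε
  have hc := hm.convexComb hℓ ha hb hab hn
  refine (toReal_risk_le hℓ (hmem hX hY a b) (m := a • m + b • n) (hc.mono ?_ (by simp))).trans ?_
  · filter_upwards [AEEqFun.coeFn_add (a • X) (b • Y), AEEqFun.coeFn_smul a X,
      AEEqFun.coeFn_smul b Y] with ω h1 h2 h3
    refine le_of_eq (congrArg ℓ ?_)
    rw [h1, Pi.add_apply, h2, h3]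
    ext k
    simp only [Pi.sub_apply, Pi.add_apply, Pi.smul_apply, smul_eq_mul]
    ring
  · simp only [Pi.add_apply, Pi.smul_apply, smul_eq_mul, Finset.sum_add_distrib, ← Finset.mul_sum]
    have h1 := mul_le_mul_of_nonneg_left hmlt.le ha.le
    have h2 := mul_le_mul_of_nonneg_left hnlt.le hb.le
    have h3 : a * ε + b * ε = ε := by rw [← add_mul, hab, one_mul]
    linarith

theorem risk_mono {ℓ : (Fin d → ℝ) → EReal} (hℓ : IsLossFunction ℓ) {P : Measure Ω}
    {X Y : Ω →ₘ[P] (Fin d → ℝ)} (h : X ≤ Y) : risk ℓ P X ≤ risk ℓ P Y := by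
  refine iInf_le_iInf_of_subset fun m hm => ?_
  refine le_trans (eexp_mono_ae ?_) hm
  filter_upwards [AEEqFun.coeFn_le.2 h] with ω hω
  exact hℓ.mono (sub_le_sub_right hω m)

theorem risk_add_const {ℓ : (Fin d → ℝ) → EReal} (hℓ : IsLossFunction ℓ) {P : Measure Ω}
    [IsProbabilityMeasure P] {X : Ω →ₘ[P] (Fin d → ℝ)} (hX : X ∈ orliczHeart (theta ℓ) P)
    (m : Fin d → ℝ) :
    risk ℓ P (X + AEEqFun.const Ω m) = risk ℓ P X + ((∑ k, m k : ℝ) : EReal) := by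
  obtain ⟨ρ, h, h1, h2⟩ := exists_risk_eq_coe hℓ hX
  have hiff : ∀ n, n ∈ acceptable ℓ P (X + AEEqFun.const Ω m) ↔ n - m ∈ acceptable ℓ P X := by
    intro n
    change eexp P _ ≤ 0 ↔ eexp P _ ≤ 0
    rw [eexp_congr_ae]
    filter_upwards [AEEqFun.coeFn_add X (AEEqFun.const Ω m),
      AEEqFun.coeFn_const (μ := P) Ω m] with ω e1 e2
    rw [e1, Pi.add_apply, e2, Function.const_apply, ← sub_sub_eq_add_sub]
  rw [h, ← EReal.coe_add]
  refine risk_eq_coe (fun n hn => ?_) fun ε hε => ?_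
  · have := h1 _ ((hiff n).1 hn)
    simp only [Pi.sub_apply, Finset.sum_sub_distrib] at this
    linarith
  · obtain ⟨n, hn, hlt⟩ := h2 ε hε
    refine ⟨n + m, (hiff _).2 (by simpa using hn), ?_⟩
    simp only [Pi.add_apply, Finset.sum_add_distrib]
    linarith

theorem risk_smul {ℓ : (Fin d → ℝ) → EReal} (hℓ : IsLossFunction ℓ) {P : Measure Ω}
    [IsProbabilityMeasure P]
    (hhom : ∀ (a : ℝ) (x : Fin d → ℝ), 0 < a → ℓ (a • x) = (a : EReal) * ℓ x)
    {a : ℝ} (ha : 0 < a) {X : Ω →ₘ[P] (Fin d → ℝ)} (hX : X ∈ orliczHeart (theta ℓ) P) :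
    risk ℓ P (a • X) = (a : EReal) * risk ℓ P X := by
  obtain ⟨ρ, h, h1, h2⟩ := exists_risk_eq_coe hℓ hX
  have hscale : ∀ {V : Ω → Fin d → ℝ} {b : ℝ}, 0 < b → ExpLE P (fun ω => ℓ (b • V ω)) 0 →
      ExpLE P (fun ω => ℓ (V ω)) 0 := fun hb hV => by
    simp only [hhom _ _ hb] at hV
    simpa using hV.of_const_mul hb
  have hiff : ∀ n, n ∈ acceptable ℓ P X ↔ a • n ∈ acceptable ℓ P (a • X) := by
    intro n
    rw [mem_acceptable_iff hℓ hX, mem_acceptable_iff hℓ (smul_mem_orliczHeart hℓ hX a)]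
    have hae : ∀ᵐ ω ∂P, (a • X : Ω →ₘ[P] (Fin d → ℝ)) ω - a • n = a • (X ω - n) := by
      filter_upwards [AEEqFun.coeFn_smul a X] with ω e
      rw [e, Pi.smul_apply, smul_sub]
    refine ⟨fun hn => ?_, fun hn => hscale ha
      (hn.mono (hae.mono fun ω e => by rw [e]) le_rfl)⟩
    refine ExpLE.mono (f := fun ω => ℓ (a • (X ω - n))) (hscale (inv_pos.2 ha) ?_)
      (hae.mono fun ω e => by rw [e]) le_rfl
    simpa [smul_smul, inv_mul_cancel₀ ha.ne'] using hn
  rw [h, ← EReal.coe_mul]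
  refine risk_eq_coe (fun n hn => ?_) fun ε hε => ?_
  · have := h1 (a⁻¹ • n) ((hiff _).2 (by rwa [smul_smul, mul_inv_cancel₀ ha.ne', one_smul]))
    simp only [Pi.smul_apply, smul_eq_mul, ← Finset.mul_sum] at this
    rwa [le_inv_mul_iff₀ ha] at this
  · obtain ⟨n, hn, hlt⟩ := h2 (ε / a) (by positivity)
    refine ⟨a • n, (hiff n).1 hn, ?_⟩
    simp only [Pi.smul_apply, smul_eq_mul, ← Finset.mul_sum]
    have := mul_lt_mul_of_pos_left hlt ha
    rwa [mul_add, mul_div_cancel₀ _ ha.ne'] at this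

/-! ### Weak and strong duality -/

theorem measurable_conj {f : (Fin d → ℝ) → EReal} (hf : ∀ x, f x ≠ ⊥) : Measurable (conj f) := by
  have : LowerSemicontinuous (conj f) := by
    refine lowerSemicontinuous_iSup fun x => Continuous.lowerSemicontinuous ?_
    by_cases htop : f x = ⊤
    · simp only [htop, EReal.sub_top]
      exact continuous_const
    · rw [← EReal.coe_toReal htop (hf x)]
      simp only [← EReal.coe_sub]
      exact continuous_coe_real_ereal.comp (by fun_prop)
  exact this.measurable

theorem exists_theta_zero_eq {ℓ : (Fin d → ℝ) → EReal} (hℓ : IsLossFunction ℓ) {P : Measure Ω}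
    [IsProbabilityMeasure P] {X : Ω →ₘ[P] (Fin d → ℝ)} (hX : X ∈ orliczHeart (theta ℓ) P) :
    ∃ t : ℝ, theta ℓ 0 = (t : EReal) := by
  obtain ⟨r, h, -, hle, -⟩ := ((mem_orliczHeart_iff hℓ).1 hX).2 0 le_rfl
  obtain ⟨ω, hω⟩ := hle.exists
  dsimp only at hω
  rw [zero_smul] at hω
  exact hℓ.exists_real (hω.trans_lt (EReal.coe_lt_top _))

/-- The point 0 in the supremum gives the minorant -θ(0), which is real because the heart contains
X. -/
theorem exists_expLE_conj_theta {ℓ : (Fin d → ℝ) → EReal} (hℓ : IsLossFunction ℓ)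
    {P : Measure Ω} [IsProbabilityMeasure P] {X Z : Ω →ₘ[P] (Fin d → ℝ)}
    (hX : X ∈ orliczHeart (theta ℓ) P) (hZ : Z ∈ densities (theta ℓ) P) :
    ∃ a r : ℝ, 0 < a ∧ ExpLE P (fun ω => conj (theta ℓ) (a • Z ω)) r := by
  obtain ⟨t, ht⟩ := exists_theta_zero_eq hℓ hX
  obtain ⟨a, ha, hlt⟩ := hZ.1
  have := exists_expLE_of_eexp_lt_top (g := fun _ => -t)
    (((measurable_conj fun x => hℓ.ne_bot _).comp
      (Z.stronglyMeasurable.measurable.const_smul a⁻¹)).aemeasurable) (integrable_const _)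
    (Eventually.of_forall fun ω => ?_) hlt
  · obtain ⟨r, hr⟩ := this
    exact ⟨a⁻¹, r, inv_pos.2 ha, hr⟩
  · refine le_trans (le_of_eq ?_) (le_iSup (fun x : Fin d → ℝ =>
      ((∑ k, x k * (a⁻¹ • Z ω) k : ℝ) : EReal) - theta ℓ x) 0)
    simp [ht]

theorem densities_nonneg {θ : (Fin d → ℝ) → EReal} {P : Measure Ω} {Z : Ω →ₘ[P] (Fin d → ℝ)}
    (hZ : Z ∈ densities θ P) : ∀ᵐ ω ∂P, 0 ≤ Z ω := by
  filter_upwards [AEEqFun.coeFn_le.2 hZ.2.1,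
    AEEqFun.coeFn_zero (α := Ω) (μ := P) (β := Fin d → ℝ)] with ω h1 h2
  rwa [h2] at h1

theorem integrable_density_mul {ℓ : (Fin d → ℝ) → EReal} (hℓ : IsLossFunction ℓ)
    {P : Measure Ω} [IsProbabilityMeasure P] {X Z : Ω →ₘ[P] (Fin d → ℝ)}
    (hX : X ∈ orliczHeart (theta ℓ) P) (hZ : Z ∈ densities (theta ℓ) P) :
    Integrable (fun ω => ∑ k, Z ω k * X ω k) P := by
  obtain ⟨a, r, ha, hE⟩ := exists_expLE_conj_theta hℓ hX hZ
  exact integrable_finsetSum _ fun k _ => integrable_mul_of_inHeart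
    ((mem_orliczHeart_iff hℓ).1 hX) Z.aestronglyMeasurable (densities_nonneg hZ) ha hE k

/-- Weak duality. -/
theorem integral_sub_penalty_le_risk {ℓ : (Fin d → ℝ) → EReal} (hℓ : IsLossFunction ℓ)
    {P : Measure Ω} [IsProbabilityMeasure P] {X Z : Ω →ₘ[P] (Fin d → ℝ)}
    (hX : X ∈ orliczHeart (theta ℓ) P) (hZ : Z ∈ densities (theta ℓ) P) :
    ((∫ ω, ∑ k, Z ω k * X ω k ∂P : ℝ) : EReal) - penalty ℓ P Z ≤ risk ℓ P X := by
  have hint := integrable_density_mul hℓ hX hZ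
  refine le_iInf₂ fun m hm => ?_
  obtain ⟨h, hh, hle, h0⟩ := (mem_acceptable_iff hℓ hX).1 hm
  have hpen : ((∫ ω, ∑ k, Z ω k * X ω k ∂P - ∑ k, m k : ℝ) : EReal) ≤ penalty ℓ P Z := by
    refine le_iInf fun ⟨l, hl⟩ => ?_
    have hmi : Integrable (fun ω => ∑ k, Z ω k * m k) P :=
      integrable_finsetSum _ fun k _ => (hZ.2.2 k).1.mul_const _
    have hdi : Integrable (fun ω => ∑ k, Z ω k * X ω k - ∑ k, Z ω k * m k) P := hint.sub hmi
    -- Fenchel's inequality gives l ℓ^*(Z / l) ≥ Z · (X - m) - l h pointwise. After integration the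
    -- h term only helps, as E[h] ≤ 0 and l > 0.
    refine le_trans ?_ (integral_coe_le_eexp (g := fun ω => ∑ k, Z ω k * X ω k -
      ∑ k, Z ω k * m k - l * h ω) (hdi.sub (hh.const_mul l)) ?_)
    · have e1 : ∫ ω, (∑ k, Z ω k * X ω k - ∑ k, Z ω k * m k - l * h ω) ∂P =
          ∫ ω, ∑ k, Z ω k * X ω k ∂P - ∑ k, m k - l * ∫ ω, h ω ∂P := by
        rw [integral_sub hdi (hh.const_mul l), integral_sub hint hmi,
          integral_const_mul, integral_finsetSum _ fun k _ => (hZ.2.2 k).1.mul_const _]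
        simp only [integral_mul_const, (hZ.2.2 _).2, one_mul]
      rw [e1]
      have := mul_nonpos_of_nonneg_of_nonpos hl.le h0
      exact_mod_cast (by linarith : ∫ ω, ∑ k, Z ω k * X ω k ∂P - ∑ k, m k ≤
        ∫ ω, ∑ k, Z ω k * X ω k ∂P - ∑ k, m k - l * ∫ ω, h ω ∂P)
    · filter_upwards [hle] with ω hω
      have hl' : (0 : EReal) < l := by exact_mod_cast hl
      rw [mul_comm, ← EReal.div_le_iff_le_mul hl' (EReal.coe_ne_top l)]
      refine le_trans ?_ (le_iSup (fun x : Fin d → ℝ =>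
        ((∑ k, x k * (l⁻¹ • Z ω) k : ℝ) : EReal) - ℓ x) (X ω - m))
      refine le_trans ?_ (EReal.sub_le_sub le_rfl hω)
      rw [← EReal.coe_div, ← EReal.coe_sub]
      refine le_of_eq (congrArg _ ?_)
      rw [sub_div, ← Finset.sum_sub_distrib, Finset.sum_div, mul_div_cancel_right₀ _ hl.ne']
      congr 1
      refine Finset.sum_congr rfl fun k _ => ?_
      simp only [Pi.smul_apply, Pi.sub_apply, smul_eq_mul]
      field_simp
  refine (EReal.sub_le_sub le_rfl hpen).trans ?_
  rw [← EReal.coe_sub]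
  exact_mod_cast (by linarith : ∫ ω, ∑ k, Z ω k * X ω k ∂P -
    (∫ ω, ∑ k, Z ω k * X ω k ∂P - ∑ k, m k) ≤ ∑ k, m k)

/-- The supremum in the dual representation is attained. -/
theorem exists_risk_eq_integral_sub_penalty {ℓ : (Fin d → ℝ) → EReal} (hℓ : IsLossFunction ℓ)
    {P : Measure Ω} [IsProbabilityMeasure P] {X : Ω →ₘ[P] (Fin d → ℝ)}
    (hX : X ∈ orliczHeart (theta ℓ) P) :
    ∃ Z ∈ densities (theta ℓ) P,
      ((∫ ω, ∑ k, Z ω k * X ω k ∂P : ℝ) : EReal) - penalty ℓ P Z = risk ℓ P X := by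
  obtain ⟨Z, hZm, hZ0, hZi, hE⟩ := exists_optimal_density hℓ ((mem_orliczHeart_iff hℓ).1 hX)
    (ρ := (risk ℓ P X).toReal) fun m hm => toReal_risk_le hℓ hX hm
  set Z' : Ω →ₘ[P] (Fin d → ℝ) := AEEqFun.mk Z hZm.aestronglyMeasurable
  have hae : ∀ᵐ ω ∂P, Z' ω = Z ω := AEEqFun.coeFn_mk Z hZm.aestronglyMeasurable
  have hZ' : Z' ∈ densities (theta ℓ) P := by
    refine ⟨?_, ?_, fun k => ?_⟩
    · obtain ⟨l, hl, hEl⟩ := hE 1 one_pos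
      refine ⟨l, hl, ((hEl.of_const_mul hl).mono ?_ le_rfl).eexp_le.trans_lt
        (EReal.coe_lt_top _)⟩
      filter_upwards [hae] with ω hω
      rw [hω]
      exact conj_theta_le (smul_nonneg (inv_nonneg.2 hl.le) (hZ0 ω))
    · rw [← AEEqFun.coeFn_le]
      filter_upwards [hae, AEEqFun.coeFn_zero (α := Ω) (μ := P) (β := Fin d → ℝ)] with ω h1 h2
      rw [h1, h2]
      exact hZ0 ω
    · have hk : (fun ω => Z' ω k) =ᵐ[P] fun ω => Z ω k := hae.mono fun ω h => by simp only [h]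
      exact ⟨(hZi k).1.congr hk.symm, (integral_congr_ae hk).trans (hZi k).2⟩
  have hI : ∫ ω, ∑ k, Z' ω k * X ω k ∂P = ∫ ω, ∑ k, Z ω k * X ω k ∂P :=
    integral_congr_ae (hae.mono fun ω h => by simp only [h])
  refine ⟨Z', hZ', le_antisymm (integral_sub_penalty_le_risk hℓ hX hZ') ?_⟩
  have hpen : penalty ℓ P Z' ≤
      ((∫ ω, ∑ k, Z ω k * X ω k ∂P - (risk ℓ P X).toReal : ℝ) : EReal) := by
    refine EReal.le_of_forall_lt_iff_le.1 fun q hq => ?_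
    have hq' : ∫ ω, ∑ k, Z ω k * X ω k ∂P - (risk ℓ P X).toReal < q := by exact_mod_cast hq
    obtain ⟨l, hl, hEl⟩ := hE _ (sub_pos.2 hq')
    refine (iInf_le _ ⟨l, hl⟩).trans ((hEl.mono ?_ (by linarith)).eexp_le)
    filter_upwards [hae] with ω hω
    rw [hω]
  refine le_trans ?_ (EReal.sub_le_sub le_rfl hpen)
  rw [hI, ← EReal.coe_sub, sub_sub_cancel, coe_toReal_risk hℓ hX]

/-! ### Luxemburg norm, subgradients and continuity -/

theorem eexp_theta_sub_le_one_iff {ℓ : (Fin d → ℝ) → EReal} (hℓ : IsLossFunction ℓ)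
    {P : Measure Ω} [IsProbabilityMeasure P] {X : Ω → Fin d → ℝ} (hX : Measurable X) {t : ℝ}
    (ht : theta ℓ 0 = (t : EReal)) :
    eexp P (fun ω => theta ℓ (X ω) - theta ℓ 0) ≤ 1 ↔
      ExpLE P (fun ω => theta ℓ (X ω)) (1 + t) := by
  rw [ht]
  constructor
  · intro h
    have hm : Measurable fun ω => theta ℓ (X ω) - (t : EReal) :=
      ((measurable_theta hℓ).comp hX).sub_const _
    obtain ⟨u, hu, hle, h1⟩ := expLE_of_eexp_le (r := 1) (g := fun _ => 0) hm.aemeasurable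
      (integrable_const _) (Eventually.of_forall fun ω => by
        have : theta ℓ 0 ≤ theta ℓ (X ω) := theta_le_theta hℓ fun k => by simp
        rw [ht] at this
        rw [EReal.coe_zero, EReal.sub_nonneg (by simp) (by simp)]
        exact this) (by exact_mod_cast h)
    refine ⟨fun ω => u ω + t, hu.add (integrable_const _), ?_, ?_⟩
    · filter_upwards [hle] with ω hω
      rw [EReal.coe_add]
      exact (EReal.sub_le_iff_le_add (by simp) (by simp)).1 hω
    · rw [integral_add hu (integrable_const _)]
      simpa using h1
  · rintro ⟨u, hu, hle, h1⟩
    have : ExpLE P (fun ω => theta ℓ (X ω) - (t : EReal)) 1 := by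
      refine ⟨fun ω => u ω - t, hu.sub (integrable_const _), ?_, ?_⟩
      · filter_upwards [hle] with ω hω
        rw [EReal.coe_sub]
        exact EReal.sub_le_sub hω le_rfl
      · rw [integral_sub hu (integrable_const _)]
        simp only [integral_const, probReal_univ, smul_eq_mul, one_mul]
        linarith
    exact_mod_cast this.eexp_le

/-- The set of which the Luxemburg norm is the infimum is nonempty. -/
theorem luxNorm_set_nonempty {ℓ : (Fin d → ℝ) → EReal} (hℓ : IsLossFunction ℓ)
    {P : Measure Ω} [IsProbabilityMeasure P] {X : Ω →ₘ[P] (Fin d → ℝ)}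
    (hX : X ∈ orliczHeart (theta ℓ) P) :
    {a : ℝ | 0 < a ∧ eexp P (fun ω => theta ℓ (a⁻¹ • X ω) - theta ℓ 0) ≤ 1}.Nonempty := by
  obtain ⟨t, ht⟩ := exists_theta_zero_eq hℓ hX
  have hX' := (mem_orliczHeart_iff hℓ).1 hX
  obtain ⟨r, hr⟩ := hX'.2 1 zero_le_one
  simp only [one_smul] at hr
  -- By convexity E[θ(X / b)] ≤ t + (r - t) / b, so b ≥ r - t suffices; the 2 also ensures b > 1,
  -- for the weights.
  set b := |r - t| + 2
  have hb : 1 < b := by have := abs_nonneg (r - t); simp only [b]; linarith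
  have hb0 : 0 < b := by linarith
  have hb1 : 0 < 1 - b⁻¹ := sub_pos.2 (inv_lt_one_of_one_lt₀ hb)
  refine ⟨b, hb0, (eexp_theta_sub_le_one_iff hℓ (hX'.1.const_smul b⁻¹) ht).2 ?_⟩
  have h0 : ExpLE P (fun _ => ℓ 0) t :=
    expLE_const (Eventually.of_forall fun _ => by simp [← ht, theta])
  refine ExpLE.mono (hr.convexComb hℓ (inv_pos.2 hb0) hb1 (by ring) h0)
    (Eventually.of_forall fun ω => hℓ.mono fun k => ?_) ?_
  · simp [abs_mul, abs_of_pos (inv_pos.2 hb0)]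
  · have h1 : b⁻¹ * (r - t) ≤ 1 := by
      rw [inv_mul_le_iff₀ hb0]
      have := le_abs_self (r - t)
      simp only [b]
      linarith
    linarith

/-- A linear functional that is bounded on the unit ball is bounded by the Luxemburg norm. -/
theorem exists_bound_integral_mul {ℓ : (Fin d → ℝ) → EReal} (hℓ : IsLossFunction ℓ)
    {P : Measure Ω} [IsProbabilityMeasure P] {Z : Ω →ₘ[P] (Fin d → ℝ)}
    (hZ : Z ∈ densities (theta ℓ) P) {X : Ω →ₘ[P] (Fin d → ℝ)}
    (hX : X ∈ orliczHeart (theta ℓ) P) :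
    ∃ C : ℝ, 0 < C ∧ ∀ Y ∈ orliczHeart (theta ℓ) P,
      |∫ ω, ∑ k, Z ω k * Y ω k ∂P| ≤ C * luxNorm (theta ℓ) P Y := by
  obtain ⟨t, ht⟩ := exists_theta_zero_eq hℓ hX
  obtain ⟨b, r, hb, hE⟩ := exists_expLE_conj_theta hℓ hX hZ
  set C := b⁻¹ * (|r + (1 + t)| + 1) with hC
  have hC0 : 0 < C := by positivity
  refine ⟨C, hC0, fun Y hY => ?_⟩
  have hY' := (mem_orliczHeart_iff hℓ).1 hY
  rw [← div_le_iff₀' hC0]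
  refine le_csInf (luxNorm_set_nonempty hℓ hY) ?_
  rintro a ⟨ha, hle⟩
  obtain ⟨h, hh, hhle, h1⟩ := (eexp_theta_sub_le_one_iff hℓ (hY'.1.const_smul a⁻¹) ht).1 hle
  obtain ⟨g, hg, hgle, h2⟩ := hE
  -- Hölder's inequality from Fenchel's, applied to Y / a and b Z; undoing the scaling produces the
  -- factor a / b.
  have hbound : |∫ ω, ∑ k, Z ω k * Y ω k ∂P| ≤ ∫ ω, a * b⁻¹ * (g ω + h ω) ∂P := by
    rw [← Real.norm_eq_abs]
    refine norm_integral_le_of_norm_le ((hg.add hh).const_mul _) ?_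
    filter_upwards [hgle, hhle, densities_nonneg hZ] with ω e1 e2 e0
    have e3 := sum_mul_abs_le e2 e1
    have e4 : ∑ k, |(a⁻¹ • Y ω) k| * (b • Z ω) k = a⁻¹ * b * ∑ k, |Z ω k * Y ω k| := by
      rw [Finset.mul_sum]
      refine Finset.sum_congr rfl fun k _ => ?_
      simp only [Pi.smul_apply, smul_eq_mul, abs_mul, abs_of_pos (inv_pos.2 ha),
        abs_of_nonneg (e0 k)]
      ring
    replace e3 := e4.symm.trans_le e3
    rw [Real.norm_eq_abs]
    refine (Finset.abs_sum_le_sum_abs _ _).trans ?_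
    have e5 := mul_le_mul_of_nonneg_left e3 (by positivity : 0 ≤ a * b⁻¹)
    have e6 : a * b⁻¹ * (a⁻¹ * b * ∑ k, |Z ω k * Y ω k|) = ∑ k, |Z ω k * Y ω k| := by
      field_simp
    rwa [e6] at e5
  rw [div_le_iff₀' hC0]
  refine hbound.trans ?_
  rw [integral_const_mul, integral_add hg hh]
  have h3 : ∫ ω, g ω ∂P + ∫ ω, h ω ∂P ≤ |r + (1 + t)| + 1 := by
    linarith [le_abs_self (r + (1 + t))]
  have h4 := mul_le_mul_of_nonneg_left h3 (by positivity : 0 ≤ a * b⁻¹)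
  refine h4.trans (le_of_eq ?_)
  rw [hC]
  ring

theorem integral_mul_add {ℓ : (Fin d → ℝ) → EReal} (hℓ : IsLossFunction ℓ)
    {P : Measure Ω} [IsProbabilityMeasure P] {X Y Z : Ω →ₘ[P] (Fin d → ℝ)}
    (hX : X ∈ orliczHeart (theta ℓ) P) (hY : Y ∈ orliczHeart (theta ℓ) P)
    (hZ : Z ∈ densities (theta ℓ) P) :
    ∫ ω, ∑ k, Z ω k * (X + Y) ω k ∂P =
      ∫ ω, ∑ k, Z ω k * X ω k ∂P + ∫ ω, ∑ k, Z ω k * Y ω k ∂P := by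
  rw [← integral_add (integrable_density_mul hℓ hX hZ) (integrable_density_mul hℓ hY hZ)]
  refine integral_congr_ae ?_
  filter_upwards [AEEqFun.coeFn_add X Y] with ω h
  simp only [h, Pi.add_apply, mul_add, Finset.sum_add_distrib]

theorem isDualFunctional_integral_mul {ℓ : (Fin d → ℝ) → EReal} (hℓ : IsLossFunction ℓ)
    {P : Measure Ω} [IsProbabilityMeasure P] {Z : Ω →ₘ[P] (Fin d → ℝ)}
    (hZ : Z ∈ densities (theta ℓ) P) {X : Ω →ₘ[P] (Fin d → ℝ)}
    (hX : X ∈ orliczHeart (theta ℓ) P) :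
    IsDualFunctional (theta ℓ) P (fun Y => ∫ ω, ∑ k, Z ω k * Y ω k ∂P) where
  add := fun X hX Y hY => integral_mul_add hℓ hX hY hZ
  smul := fun a X _ => by
    rw [← integral_const_mul]
    refine integral_congr_ae ?_
    filter_upwards [AEEqFun.coeFn_smul a X] with ω h
    simp only [h, Pi.smul_apply, smul_eq_mul, Finset.mul_sum]
    exact Finset.sum_congr rfl fun k _ => by ring
  bound := by
    obtain ⟨C, -, hC⟩ := exists_bound_integral_mul hℓ hZ hX
    exact ⟨C, hC⟩

/-- A density optimal at X satisfies the dual inequality at every Y with equality at X, and the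
penalty cancels in the difference. It is real because equality holds with a real risk. -/
theorem exists_subgradient {ℓ : (Fin d → ℝ) → EReal} (hℓ : IsLossFunction ℓ)
    {P : Measure Ω} [IsProbabilityMeasure P] {X : Ω →ₘ[P] (Fin d → ℝ)}
    (hX : X ∈ orliczHeart (theta ℓ) P) :
    (subdifferential (theta ℓ) P (fun Y => (risk ℓ P Y).toReal) X).Nonempty := by
  obtain ⟨Z, hZ, heq⟩ := exists_risk_eq_integral_sub_penalty hℓ hX
  refine ⟨_, isDualFunctional_integral_mul hℓ hZ hX, fun Y hY => ?_⟩
  have hle := integral_sub_penalty_le_risk hℓ hY hZ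
  have hadd := integral_mul_add hℓ hX (sub_mem_orliczHeart hℓ hY hX) hZ
  rw [add_sub_cancel] at hadd
  rw [← coe_toReal_risk hℓ hX] at heq
  rw [← coe_toReal_risk hℓ hY, hadd] at hle
  have hpen : ∃ p : ℝ, penalty ℓ P Z = (p : EReal) := by
    refine ⟨(penalty ℓ P Z).toReal, (EReal.coe_toReal ?_ ?_).symm⟩
    · intro h
      rw [h, EReal.sub_top] at heq
      exact EReal.coe_ne_bot _ heq.symm
    · intro h
      rw [h, EReal.coe_sub_bot] at heq
      exact EReal.coe_ne_top _ heq.symm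
  obtain ⟨p, hp⟩ := hpen
  rw [hp, ← EReal.coe_sub] at heq hle
  have h1 := EReal.coe_eq_coe_iff.1 heq
  have h2 := EReal.coe_le_coe_iff.1 hle
  dsimp only
  linarith

/-- The risk is bounded above in a neighbourhood of each point of the Orlicz heart. -/
theorem exists_risk_le_of_expLE_theta {ℓ : (Fin d → ℝ) → EReal} (hℓ : IsLossFunction ℓ)
    {P : Measure Ω} [IsProbabilityMeasure P] {X : Ω →ₘ[P] (Fin d → ℝ)}
    (hX : X ∈ orliczHeart (theta ℓ) P) (r : ℝ) :
    ∃ s K : ℝ, 0 < s ∧ ∀ H ∈ orliczHeart (theta ℓ) P, ExpLE P (fun ω => theta ℓ (H ω)) r →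
      (risk ℓ P (X + s • H)).toReal ≤ K := by
  obtain ⟨δ, x, hδ, hx⟩ := hℓ.exists_neg
  have hX' := (mem_orliczHeart_iff hℓ).1 hX
  -- Small enough that the slack δ absorbs the loss r of H: (1 - s)(-δ) + s r ≤ 0. Dividing X by 1 -
  -- s makes X + s H minus a constant a convex combination with weights 1 - s and s.
  set s := δ / (δ + |r| + 1) with hs
  have hden : 0 < δ + |r| + 1 := by positivity
  have hs0 : 0 < s := by positivity
  have hs1 : 0 < 1 - s := by
    have : s < 1 := (div_lt_one hden).2 (by linarith [abs_nonneg r])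
    linarith
  have hsr : (1 - s) * -δ + s * r ≤ 0 := by
    have h1 : s * (δ + |r| + 1) = δ := by rw [hs]; field_simp
    have h2 := mul_le_mul_of_nonneg_left (le_abs_self r) hs0.le
    linarith
  obtain ⟨n, hn⟩ := exists_expLE_sub_const hℓ hX'
    (Y := (1 - s)⁻¹ • (X : Ω → Fin d → ℝ))
    ((dominated _).smul_mem _ (self_mem_dominated hX'.1)) hx
  refine ⟨s, _, hs0, fun H hH hE => toReal_risk_le hℓ
    (add_mem_orliczHeart hℓ hX (smul_mem_orliczHeart hℓ hH s)) (m := fun _ => (1 - s) * n) ?_⟩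
  have hH' : ExpLE P (fun ω => ℓ (H ω)) r :=
    hE.mono (Eventually.of_forall fun ω => le_theta hℓ fun k => le_abs_self _) le_rfl
  refine (hn.convexComb hℓ hs1 hs0 (by ring) hH').mono ?_ hsr
  filter_upwards [AEEqFun.coeFn_add X (s • H), AEEqFun.coeFn_smul s H] with ω h1 h2
  refine le_of_eq (congrArg ℓ ?_)
  rw [h1, Pi.add_apply, h2]
  ext k
  simp only [Pi.sub_apply, Pi.add_apply, Pi.smul_apply, smul_eq_mul]
  field_simp
  ring

/-- The subgradient at X controls the decrease of the risk. The increase is controlled by convexity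
and an upper bound on a ball around X. -/
theorem continuousOnHeart_risk {ℓ : (Fin d → ℝ) → EReal} (hℓ : IsLossFunction ℓ)
    {P : Measure Ω} [IsProbabilityMeasure P] :
    ContinuousOnHeart (theta ℓ) P (fun X => (risk ℓ P X).toReal) := by
  intro X hX ε hε
  obtain ⟨t, ht⟩ := exists_theta_zero_eq hℓ hX
  obtain ⟨s, K, hs, hK⟩ := exists_risk_le_of_expLE_theta hℓ hX (1 + t)
  obtain ⟨ξ, ⟨-, -, C, hC⟩, hsub⟩ := exists_subgradient hℓ hX
  set R := (risk ℓ P X).toReal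
  have hlow : ∀ δ, 0 < δ → δ ≤ ε / (|C| + 1) → ∀ Y ∈ orliczHeart (theta ℓ) P,
      luxNorm (theta ℓ) P (Y - X) < δ → -ε < (risk ℓ P Y).toReal - R := by
    intro δ hδ hδε Y hY hlt
    have h1 := hsub Y hY
    have h2 := hC _ (sub_mem_orliczHeart hℓ hY hX)
    have hn0 : 0 ≤ luxNorm (theta ℓ) P (Y - X) :=
      Real.sInf_nonneg fun a ha => ha.1.le
    have h3 : C * luxNorm (theta ℓ) P (Y - X) ≤ |C| * δ :=
      mul_le_mul (le_abs_self C) hlt.le hn0 (abs_nonneg C)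
    have h4 : |C| * δ < ε := by
      have := mul_le_mul_of_nonneg_left hδε (by positivity : 0 ≤ |C| + 1)
      rw [mul_div_cancel₀ _ (by positivity : |C| + 1 ≠ 0)] at this
      linarith
    have h5 := neg_abs_le (ξ (Y - X))
    dsimp only at h1
    linarith
  -- The first term serves the subgradient bound. The second gives a ≤ s, so that a / s is a convex
  -- weight, and the third gives (a / s)(K - R) < ε.
  set δ := min (ε / (|C| + 1)) (min s (s * ε / (|K - R| + 1))) with hδdef
  have hδ : 0 < δ := lt_min (by positivity) (lt_min hs (by positivity))
  refine ⟨δ, hδ, fun Y hY hlt => ?_⟩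
  refine abs_lt.2 ⟨hlow δ hδ (min_le_left _ _) Y hY hlt, ?_⟩
  obtain ⟨a, ⟨ha, hle⟩, haδ⟩ :=
    exists_lt_of_csInf_lt (luxNorm_set_nonempty hℓ (sub_mem_orliczHeart hℓ hY hX)) hlt
  have hD := sub_mem_orliczHeart hℓ hY hX
  have hH := smul_mem_orliczHeart hℓ hD a⁻¹
  have hE : ExpLE P (fun ω => theta ℓ ((a⁻¹ • (Y - X) : Ω →ₘ[P] (Fin d → ℝ)) ω)) (1 + t) := by
    refine ((eexp_theta_sub_le_one_iff hℓ
      (((mem_orliczHeart_iff hℓ).1 hD).1.const_smul a⁻¹) ht).1 hle).mono ?_ le_rfl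
    filter_upwards [AEEqFun.coeFn_smul a⁻¹ (Y - X)] with ω h
    rw [h, Pi.smul_apply]
  have hKle := hK _ hH hE
  have has : a / s ≤ 1 := by
    rw [div_le_one hs]
    exact haδ.le.trans ((min_le_right _ _).trans (min_le_left _ _))
  have hconv := (convexOn_risk hℓ (P := P)).2 hX
    (add_mem_orliczHeart hℓ hX (smul_mem_orliczHeart hℓ hH s))
    (sub_nonneg.2 has) (by positivity : 0 ≤ a / s) (by ring)
  -- Y lies on the segment from X to X + s a⁻¹ (Y - X), and the risk is at most `K` at the far end.
  have hcomb : (1 - a / s) • X + (a / s) • (X + s • a⁻¹ • (Y - X)) = Y := by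
    rw [smul_add, smul_smul, smul_smul]
    have : a / s * (s * a⁻¹) = 1 := by field_simp
    rw [mul_assoc, this, one_smul, sub_smul, one_smul]
    abel
  rw [hcomb] at hconv
  simp only [smul_eq_mul] at hconv
  have h1 := mul_le_mul_of_nonneg_left hKle (by positivity : 0 ≤ a / s)
  have h2 : a / s * (K - R) < ε := by
    have h3 : a < s * ε / (|K - R| + 1) :=
      haδ.trans_le ((min_le_right _ _).trans (min_le_right _ _))
    rw [lt_div_iff₀ (by positivity)] at h3
    rw [div_mul_eq_mul_div, div_lt_iff₀ hs]
    have h4 := mul_le_mul_of_nonneg_left (le_abs_self (K - R)) ha.le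
    linarith
  dsimp only
  linarith

end Shortfall

open Shortfall in
theorem mainTheorem2 {Ω : Type*} [MeasurableSpace Ω] (P : Measure Ω) [IsProbabilityMeasure P]
    {d : ℕ} (ℓ : (Fin d → ℝ) → EReal) (hℓ : IsLossFunction ℓ) :
    -- real valued
    (∀ X ∈ orliczHeart (theta ℓ) P, risk ℓ P X ≠ ⊥ ∧ risk ℓ P X ≠ ⊤) ∧
    -- convex
    ConvexOn ℝ (orliczHeart (theta ℓ) P) (fun X => (risk ℓ P X).toReal) ∧
    -- monotone
    MonotoneOn (risk ℓ P) (orliczHeart (theta ℓ) P) ∧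
    -- translation invariant
    (∀ X ∈ orliczHeart (theta ℓ) P, ∀ m : Fin d → ℝ,
      risk ℓ P (X + AEEqFun.const Ω m) = risk ℓ P X + ((∑ k, m k : ℝ) : EReal)) ∧
    -- continuous
    ContinuousOnHeart (theta ℓ) P (fun X => (risk ℓ P X).toReal) ∧
    -- subdifferentiable
    (∀ X ∈ orliczHeart (theta ℓ) P,
      (subdifferential (theta ℓ) P (fun Y => (risk ℓ P Y).toReal) X).Nonempty) ∧
    -- positively homogeneous if the loss function is
    ((∀ (a : ℝ) (x : Fin d → ℝ), 0 < a → ℓ (a • x) = (a : EReal) * ℓ x) →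
      ∀ (a : ℝ), 0 < a → ∀ X ∈ orliczHeart (theta ℓ) P,
        risk ℓ P (a • X) = (a : EReal) * risk ℓ P X) ∧
    -- the expectation `E_Q[X] = E[dQ/dP · X]` is well defined
    (∀ Z ∈ densities (theta ℓ) P, ∀ X ∈ orliczHeart (theta ℓ) P,
      Integrable (fun ω => ∑ k, Z ω k * X ω k) P) ∧
    -- dual representation, with attained maximum
    (∀ X ∈ orliczHeart (theta ℓ) P,
      IsGreatest
        ((fun Z : Ω →ₘ[P] (Fin d → ℝ) =>
            ((∫ ω, ∑ k, Z ω k * X ω k ∂P : ℝ) : EReal) - penalty ℓ P Z) ''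
          densities (theta ℓ) P)
        (risk ℓ P X)) := by
  refine ⟨fun X hX => ?_, convexOn_risk hℓ, fun X _ Y _ h => risk_mono hℓ h,
    fun X hX m => risk_add_const hℓ hX m, continuousOnHeart_risk hℓ,
    fun X hX => exists_subgradient hℓ hX, fun hhom a ha X hX => risk_smul hℓ hhom ha hX,
    fun Z hZ X hX => integrable_density_mul hℓ hX hZ,
    fun X hX => ⟨exists_risk_eq_integral_sub_penalty hℓ hX, ?_⟩⟩
  · rw [← coe_toReal_risk hℓ hX]
    exact ⟨EReal.coe_ne_bot _, EReal.coe_ne_top _⟩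
  · rintro _ ⟨Z, hZ, rfl⟩
    exact integral_sub_penalty_le_risk hℓ hX hZ
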